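/- Let $p\in[1,\infty)$ and let $q_1,q_2\in L_p(0,1)$ be real-valued. Put $$B=\begin{pmatrix}0&1\\-1&0\end{pmatrix},\qquad Q=\begin{pmatrix}q_1&q_2\\q_2&-q_1\end{pmatrix},\qquad \ell_Q\mathbf u=B\mathbf u'+Q\mathbf u .$$ In $\mathbf H=L_2(0,1)\times L_2(0,1)$ (complex-valued functions, with norm $\|\cdot\|$) let $A_1$ be the Dirac operator $A_1\mathbf u=\ell_Q\mathbf u$ on the domain of all $\mathbf u=(u_1,u_2)^{\mathrm t}$ with $u_1,u_2$ absolutely continuous on $[0,1]$, $\ell_Q\mathbf u\in\mathbf H$ and $u_2(0)=u_1(1)=0$. For $\lambda\in\mathbb C$ let $\mathbf c(\cdot,\lambda)=(c_1,c_2)^{\mathrm t}$ be the absolutely continuous solution of $\ell_Q\mathbf c=\lambda\mathbf c$ (almost everywhere on $(0,1)$) with $c_1(0,\lambda)=1$, $c_2(0,\lambda)=0$. Then the eigenvalues of $A_1$ are real and can be listed as a strictly increasing sequence $(\lambda_n)_{n\in\mathbb Z}$. For every such listing the solutions $\mathbf c(\cdot,\lambda_n)$ exist, and there is a complex-valued function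 $g\in L_p(0,1)$ such that the norming constants $\alpha_n=\|\mathbf c(\cdot,\lambda_n)\|^{-2}$ satisfy $$\alpha_n=1+e_n(g)\quad\text{for all } n\in\mathbb Z,\qquad\text{where } e_n(g)=\int_0^1 e^{-2\pi i n x}g(x)\,dx .$$ -/

import Mathlib

open MeasureTheory

noncomputable section

/-- Lebesgue measure on the interval `(0,1)`. -/
def volUnit : Measure ℝ := volume.restrict (Set.Ioo (0 : ℝ) 1)

/-- The matrix `B`. -/
def diracB : Matrix (Fin 2) (Fin 2) ℂ := !![0, 1; -1, 0]

/-- The real matrix potential `Q` with entries `q₁, q₂, q₂, -q₁`. -/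
def diracQ (q₁ q₂ : ℝ → ℝ) (x : ℝ) : Matrix (Fin 2) (Fin 2) ℂ :=
  !![(q₁ x : ℂ), (q₂ x : ℂ); (q₂ x : ℂ), -(q₁ x : ℂ)]

/-- The differential expression `ℓ_Q u = B u' + Q u`. The components `u₁, u₂` of the column vector
`u` are `u · 0` and `u · 1`. For absolutely continuous `u` the derivative exists almost everywhere
on `(0,1)`, and only these values matter below. -/
def diracExpr (q₁ q₂ : ℝ → ℝ) (u : ℝ → Fin 2 → ℂ) (x : ℝ) : Fin 2 → ℂ :=
  Matrix.mulVec diracB (fun i => deriv (fun t => u t i) x) + Matrix.mulVec (diracQ q₁ q₂ x) (u x)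

/-- Both components of `u` are absolutely continuous on `[0,1]`. -/
def IsAC (u : ℝ → Fin 2 → ℂ) : Prop :=
  ∀ i, AbsolutelyContinuousOnInterval (fun x => u x i) 0 1

/-- `u` is a solution on `(0,1)` of `ℓ_Q u = lam u`. -/
def IsDiracSolution (q₁ q₂ : ℝ → ℝ) (lam : ℂ) (u : ℝ → Fin 2 → ℂ) : Prop :=
  IsAC u ∧ ∀ᵐ x ∂volUnit, diracExpr q₁ q₂ u x = lam • u x

/-- `u` represents an element of the domain of the operator `A₁`: `u₁, u₂` are absolutely
continuous, `ℓ_Q u` lies in `L₂(0,1) × L₂(0,1)`, and `u₂(0) = u₁(1) = 0`. -/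
def InDomA₁ (q₁ q₂ : ℝ → ℝ) (u : ℝ → Fin 2 → ℂ) : Prop :=
  IsAC u ∧ (∀ i, MemLp (fun x => diracExpr q₁ q₂ u x i) 2 volUnit) ∧ u 0 1 = 0 ∧ u 1 0 = 0

/-- The set of eigenvalues of `A₁`. -/
def eigenvaluesA₁ (q₁ q₂ : ℝ → ℝ) : Set ℂ :=
  {lam | ∃ u : ℝ → Fin 2 → ℂ, InDomA₁ q₁ q₂ u ∧ ¬ (∀ᵐ x ∂volUnit, u x = 0) ∧
    ∀ᵐ x ∂volUnit, diracExpr q₁ q₂ u x = lam • u x}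

/-- `c` is the solution `c(·,lam)` of `ℓ_Q c = lam c` with `c₁(0) = 1` and `c₂(0) = 0`
(uniquely determined on `[0,1]`). -/
def IsCSolution (q₁ q₂ : ℝ → ℝ) (lam : ℂ) (c : ℝ → Fin 2 → ℂ) : Prop :=
  IsDiracSolution q₁ q₂ lam c ∧ c 0 0 = 1 ∧ c 0 1 = 0

/-- The norm of `L₂(0,1) × L₂(0,1)`. -/
def normH (u : ℝ → Fin 2 → ℂ) : ℝ :=
  Real.sqrt (∫ x, (‖u x 0‖ ^ 2 + ‖u x 1‖ ^ 2) ∂volUnit)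

/-- The Fourier coefficient `e_n(g) = ∫₀¹ exp(-2πinx) g(x) dx`. -/
def fourierE (g : ℝ → ℂ) (n : ℤ) : ℂ :=
  ∫ x, Complex.exp (-2 * Real.pi * n * Complex.I * x) * g x ∂volUnit

/-- `lam` lists the eigenvalues of `A₁`, all of them real, in strictly increasing order. -/
def EnumeratesA₁ (q₁ q₂ : ℝ → ℝ) (lam : ℤ → ℝ) : Prop :=
  StrictMono lam ∧ Set.range (fun n => (lam n : ℂ)) = eigenvaluesA₁ q₁ q₂

end

/-! For real `lam` the system becomes `z' = i lam z + q conj z`, where `z = c₁ + i c₂` and `q = q₂ -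
i q₁`. With `z = exp(i lam x) a`, the amplitude satisfies `a' = q exp(-2 i lam x) conj a`. Iterating
this equation gives `a(x) = 1 + ∫ A(x,s) exp(-2 i lam s) ds`, with a kernel `A(x,·)` that depends
continuously on `x` as an element of `L_p` (`amplitude_eq`, `continuousOn_kernel`). Since `|z| =
|a|`, the norming constant is the inverse of `∫ |a|²`.

The Prüfer angle of `z` at `1` is a strictly increasing continuous bijection of `ℝ` in `lam`, and
the eigenvalues are the points where it equals `π (n + 1/2)` (`exists_angle_sub_eq`,
`surjective_angle`, `mem_eigenvaluesA₁_iff`). Set `X n = 2i (lam n - π (n + 1/2))`. The boundary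
condition at `1` reads `exp(X n) a(1) = conj a(1)`. Once the exponentials are expanded, this is an
equation `exp(X n) - 1 = ∑ (X n)^k fc n (C k)` with fixed `C k` in `L_p`.

On the circle `L_p` is a convolution algebra and each `fc n` is multiplicative. The equation can
therefore be solved once in `L_p` by a contraction and compared with its scalar version for each
`n`. The smallness this needs costs only finitely many coefficients, which can be corrected by a
trigonometric polynomial (`exists_fc_eq_of_exp_eq`). Hence `X n` is a sequence of Fourier
coefficients of an `L_p` function. Substituting it in the kernel representation shows the same for
`a(x) - 1` (`fc_substOp`), then for `|a|² - 1` by convolution, and for its integral over `x`. A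
Wiener-type inversion (`exists_fc_eq_inv`) gives the norming constants. An arbitrary listing differs
from the Prüfer numbering by a translation, which a character absorbs. -/

noncomputable section

open Set Filter Topology ENNReal

/-! ### Absolutely continuous functions on the unit interval as primitives -/

section Primitive

variable {F : Type*} [NormedAddCommGroup F] [NormedSpace ℝ F]

/-- On `[0,1]`, `f` is a primitive of the integrable function `f'`. -/
def HasPrim (f f' : ℝ → F) : Prop :=
  IntervalIntegrable f' volume 0 1 ∧ ∀ x ∈ Icc (0 : ℝ) 1, f x = f 0 + ∫ t in (0 : ℝ)..x, f' t

theorem AbsolutelyContinuousOnInterval.of_dist_le {X Y : Type*} [PseudoMetricSpace X]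
    [PseudoMetricSpace Y] {f : ℝ → X} {g : ℝ → Y} {a b K : ℝ}
    (hg : AbsolutelyContinuousOnInterval g a b)
    (h : ∀ x ∈ uIcc a b, ∀ y ∈ uIcc a b, dist (f x) (f y) ≤ K * dist (g x) (g y)) :
    AbsolutelyContinuousOnInterval f a b := by
  unfold AbsolutelyContinuousOnInterval at hg ⊢
  refine squeeze_zero' (Eventually.of_forall fun _ ↦ Finset.sum_nonneg fun _ _ ↦ dist_nonneg) ?_
    (by simpa using hg.const_mul K)
  rw [eventually_inf_principal]
  filter_upwards with E hE
  rw [Finset.mul_sum]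
  exact Finset.sum_le_sum fun i hi ↦ h _ (hE.1 i hi).1 _ (hE.1 i hi).2

omit [NormedSpace ℝ F] in
theorem intervalIntegrable_sub_of_mem {f : ℝ → F} (hf : IntervalIntegrable f volume 0 1) {x y : ℝ}
    (hx : x ∈ Icc (0 : ℝ) 1) (hy : y ∈ Icc (0 : ℝ) 1) : IntervalIntegrable f volume x y :=
  hf.mono_set (by
    rw [uIcc_of_le (zero_le_one' ℝ)]
    exact uIcc_subset_Icc hx hy)

theorem HasPrim.absolutelyContinuous {f f' : ℝ → F} (h : HasPrim f f') :
    AbsolutelyContinuousOnInterval f 0 1 := by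
  refine (h.1.norm.absolutelyContinuousOnInterval_intervalIntegral
    (c := 0) (by simp)).of_dist_le (K := 1) fun x hx y hy ↦ ?_
  rw [uIcc_of_le zero_le_one] at hx hy
  have h0 : (0 : ℝ) ∈ Icc (0 : ℝ) 1 := by simp
  rw [h.2 x hx, h.2 y hy, dist_add_left, dist_eq_norm, one_mul, dist_eq_norm,
    intervalIntegral.integral_interval_sub_left (intervalIntegrable_sub_of_mem h.1 h0 hx)
      (intervalIntegrable_sub_of_mem h.1 h0 hy),
    intervalIntegral.integral_interval_sub_left (intervalIntegrable_sub_of_mem h.1.norm h0 hx)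
      (intervalIntegrable_sub_of_mem h.1.norm h0 hy)]
  exact intervalIntegral.norm_integral_le_abs_integral_norm

theorem HasPrim.continuousOn {f f' : ℝ → F} (h : HasPrim f f') : ContinuousOn f (Icc 0 1) := by
  simpa using h.absolutelyContinuous.continuousOn

theorem HasPrim.intervalIntegrable {f f' : ℝ → F} (h : HasPrim f f') :
    IntervalIntegrable f volume 0 1 :=
  ContinuousOn.intervalIntegrable (by simpa using h.continuousOn)

theorem ae_mem_Ioo_of_ae_mem_Icc {P : ℝ → Prop} (h : ∀ᵐ x, x ∈ Ioo (0 : ℝ) 1 → P x) :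
    ∀ᵐ x, x ∈ Icc (0 : ℝ) 1 → P x := by
  have h₁ : ∀ᵐ x : ℝ, x ≠ 0 := by simp [ae_iff, measure_singleton]
  have h₂ : ∀ᵐ x : ℝ, x ≠ 1 := by simp [ae_iff, measure_singleton]
  filter_upwards [h, h₁, h₂] with x hx h1 h2 h3
  exact hx ⟨lt_of_le_of_ne h3.1 h1.symm, lt_of_le_of_ne h3.2 h2⟩

theorem HasPrim.ae_hasDerivAt [CompleteSpace F] {f f' : ℝ → F} (h : HasPrim f f') :
    ∀ᵐ x, x ∈ Icc (0 : ℝ) 1 → HasDerivAt f (f' x) x := by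
  apply ae_mem_Ioo_of_ae_mem_Icc
  filter_upwards [h.1.ae_hasDerivAt_integral] with x hx hx'
  have hd := (hx (by simpa using Ioo_subset_Icc_self hx') 0 (by simp)).const_add (f 0)
  refine hd.congr_of_eventuallyEq ?_
  filter_upwards [Ioo_mem_nhds hx'.1 hx'.2] with y hy
  exact h.2 y (Ioo_subset_Icc_self hy)

/-- The difference of `f` and the integral of `f'` is absolutely continuous with derivative zero
almost everywhere, hence constant. The product and exponential rules below are reduced to this. -/
theorem HasPrim.of_ae_hasDerivAt [CompleteSpace F] {f f' : ℝ → F}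
    (hf : AbsolutelyContinuousOnInterval f 0 1) (hf' : IntervalIntegrable f' volume 0 1)
    (h : ∀ᵐ x, x ∈ Icc (0 : ℝ) 1 → HasDerivAt f (f' x) x) : HasPrim f f' := by
  refine ⟨hf', ?_⟩
  have hG : HasPrim (fun x ↦ ∫ t in (0 : ℝ)..x, f' t) f' := ⟨hf', fun x _ ↦ by simp⟩
  obtain ⟨C, hC⟩ := (hf.sub hG.absolutelyContinuous).const_of_ae_hasDerivAt_zero (by
    filter_upwards [h, hG.ae_hasDerivAt] with x h1 h2 h3
    rw [uIcc_of_le zero_le_one] at h3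
    convert! (h1 h3).sub (h2 h3)
    simp)
  intro x hx
  have h0 := hC 0 (by simp)
  have h1 := hC x (by simpa using hx)
  simp only [Pi.sub_apply, intervalIntegral.integral_same, sub_zero] at h0 h1
  rw [h0, ← h1]
  abel

theorem HasPrim.add {f f' g g' : ℝ → F} (hf : HasPrim f f') (hg : HasPrim g g') :
    HasPrim (fun x ↦ f x + g x) (fun x ↦ f' x + g' x) := by
  refine ⟨hf.1.add hg.1, fun x hx ↦ ?_⟩
  have h0 : (0 : ℝ) ∈ Icc (0 : ℝ) 1 := by simp
  rw [intervalIntegral.integral_add (intervalIntegrable_sub_of_mem hf.1 h0 hx)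
    (intervalIntegrable_sub_of_mem hg.1 h0 hx)]
  beta_reduce
  rw [hf.2 x hx, hg.2 x hx]
  abel

theorem HasPrim.clm {G : Type*} [NormedAddCommGroup G] [NormedSpace ℝ G] [CompleteSpace F]
    [CompleteSpace G] {f f' : ℝ → F} (hf : HasPrim f f') (L : F →L[ℝ] G) :
    HasPrim (fun x ↦ L (f x)) (fun x ↦ L (f' x)) := by
  refine ⟨⟨L.integrable_comp hf.1.1, L.integrable_comp hf.1.2⟩, fun x hx ↦ ?_⟩
  beta_reduce
  rw [hf.2 x hx, map_add, L.intervalIntegral_comp_comm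
    (intervalIntegrable_sub_of_mem hf.1 (by simp) hx)]

theorem HasPrim.congr {f f' g g' : ℝ → F} (hf : HasPrim f f')
    (h : ∀ x ∈ Icc (0 : ℝ) 1, g x = f x) (h' : ∀ᵐ x, x ∈ Icc (0 : ℝ) 1 → g' x = f' x) :
    HasPrim g g' := by
  have hsub : ∀ x ∈ Icc (0 : ℝ) 1, ∀ᵐ t, t ∈ uIoc 0 x → f' t = g' t := by
    intro x hx
    filter_upwards [h'] with t ht h1
    rw [uIoc_of_le hx.1] at h1
    exact (ht ⟨h1.1.le, h1.2.trans hx.2⟩).symm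
  refine ⟨hf.1.congr_ae ((ae_restrict_iff' measurableSet_uIoc).2 (hsub 1 (by simp))),
    fun x hx ↦ ?_⟩
  rw [h x hx, hf.2 x hx, h 0 (by simp), intervalIntegral.integral_congr_ae (hsub x hx)]

theorem HasPrim.const (c : F) : HasPrim (fun _ ↦ c) (fun _ ↦ 0) :=
  ⟨intervalIntegrable_const, fun x _ ↦ by simp⟩

theorem HasPrim.mul {A : Type*} [NormedRing A] [NormMulClass A] [NormedAlgebra ℝ A]
    [CompleteSpace A] {f f' g g' : ℝ → A} (hf : HasPrim f f') (hg : HasPrim g g') :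
    HasPrim (fun x ↦ f x * g x) (fun x ↦ f' x * g x + f x * g' x) := by
  apply HasPrim.of_ae_hasDerivAt
  · exact hf.absolutelyContinuous.smul hg.absolutelyContinuous
  · exact (hf.1.mul_continuousOn (by simpa using hg.continuousOn)).add
      (hg.1.continuousOn_mul (by simpa using hf.continuousOn))
  · filter_upwards [hf.ae_hasDerivAt, hg.ae_hasDerivAt] with x h1 h2 h3
    exact (h1 h3).mul (h2 h3)

theorem HasPrim.cexp {f f' : ℝ → ℂ} (hf : HasPrim f f') :
    HasPrim (fun x ↦ Complex.exp (f x)) (fun x ↦ Complex.exp (f x) * f' x) := by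
  have hc : ContinuousOn (fun x ↦ Complex.exp (f x)) (Icc 0 1) :=
    Complex.continuous_exp.comp_continuousOn hf.continuousOn
  apply HasPrim.of_ae_hasDerivAt
  -- The exponential is Lipschitz only on bounded sets; `f` stays in a ball because it is continuous
  -- on a compact interval.
  · obtain ⟨R, hR⟩ := isCompact_Icc.exists_bound_of_continuousOn hf.continuousOn
    obtain ⟨K, hK⟩ := (Complex.contDiff_exp (𝕜 := ℝ) (n := 1)).contDiffOn.exists_lipschitzOnWith
      (by decide) (convex_closedBall (0 : ℂ) R) (isCompact_closedBall 0 R)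
    refine hf.absolutelyContinuous.of_dist_le (K := K) fun x hx y hy ↦ ?_
    rw [uIcc_of_le zero_le_one] at hx hy
    exact hK.dist_le_mul _ (by simpa using hR x hx) _ (by simpa using hR y hy)
  · exact hf.1.continuousOn_mul (by simpa using hc)
  · filter_upwards [hf.ae_hasDerivAt] with x h1 h3
    exact (h1 h3).cexp

theorem HasPrim.rexp {f f' : ℝ → ℝ} (hf : HasPrim f f') :
    HasPrim (fun x ↦ Real.exp (f x)) (fun x ↦ Real.exp (f x) * f' x) := by
  have h := ((hf.clm Complex.ofRealCLM).cexp).clm Complex.reCLM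
  refine h.congr (fun x _ ↦ ?_) (ae_of_all _ fun x _ ↦ ?_)
  · simp [Complex.exp_ofReal_re]
  · simp only [Complex.ofRealCLM_apply, ← Complex.ofReal_exp, ← Complex.ofReal_mul,
      Complex.reCLM_apply, Complex.ofReal_re]

theorem HasPrim.of_absolutelyContinuous {f : ℝ → ℂ} (hf : AbsolutelyContinuousOnInterval f 0 1) :
    HasPrim f (deriv f) ∧ ∀ᵐ x, x ∈ Icc (0 : ℝ) 1 → DifferentiableAt ℝ f x := by
  have hre : AbsolutelyContinuousOnInterval (fun x ↦ (f x).re) 0 1 :=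
    hf.of_dist_le (K := 1) fun x _ y _ ↦ by
      rw [one_mul, dist_eq_norm, dist_eq_norm, ← Complex.sub_re]
      exact Complex.abs_re_le_norm _
  have him : AbsolutelyContinuousOnInterval (fun x ↦ (f x).im) 0 1 :=
    hf.of_dist_le (K := 1) fun x _ y _ ↦ by
      rw [one_mul, dist_eq_norm, dist_eq_norm, ← Complex.sub_im]
      exact Complex.abs_im_le_norm _
  have hD : ∀ᵐ x, x ∈ Icc (0 : ℝ) 1 → HasDerivAt f
      ((deriv (fun x ↦ (f x).re) x : ℝ) + (deriv (fun x ↦ (f x).im) x : ℝ) * Complex.I) x := by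
    filter_upwards [hre.ae_differentiableAt, him.ae_differentiableAt] with x h1 h2 h3
    rw [uIcc_of_le zero_le_one] at h1 h2
    have := (h1 h3).hasDerivAt.ofReal_comp.add ((h2 h3).hasDerivAt.ofReal_comp.mul_const Complex.I)
    refine this.congr_of_eventuallyEq (Eventually.of_forall fun y ↦ ?_)
    simp
  have hP := HasPrim.of_ae_hasDerivAt hf
    (IntervalIntegrable.add ⟨hre.intervalIntegrable_deriv.1.ofReal,
      hre.intervalIntegrable_deriv.2.ofReal⟩ (IntervalIntegrable.mul_const
        ⟨him.intervalIntegrable_deriv.1.ofReal, him.intervalIntegrable_deriv.2.ofReal⟩ Complex.I)) hD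
  refine ⟨hP.congr (fun _ _ ↦ rfl) ?_, ?_⟩
  · filter_upwards [hD] with x h1 h2 using (h1 h2).deriv
  · filter_upwards [hD] with x h1 h2 using (h1 h2).differentiableAt

theorem HasPrim.eq_of_ae_zero {f f' : ℝ → F} (hf : HasPrim f f')
    (h : ∀ᵐ x, x ∈ Icc (0 : ℝ) 1 → f' x = 0) {x : ℝ} (hx : x ∈ Icc (0 : ℝ) 1) : f x = f 0 := by
  have := hf.congr (g' := fun _ ↦ 0) (fun _ _ ↦ rfl) (by
    filter_upwards [h] with t h1 h2 using (h1 h2).symm)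
  simpa using this.2 x hx

end Primitive

/-! ### Passage between the circle and the interval `(0,1]` -/

/-- The normalised Haar measure of the circle `ℝ ⧸ ℤ`. -/
abbrev circMeas : Measure UnitAddCircle := AddCircle.haarAddCircle

/-- The complex `L_p` space of the circle. -/
abbrev CircLp (p : ℝ≥0∞) : Type := Lp ℂ p circMeas

theorem circMeas_eq_volume : circMeas = volume := by
  rw [AddCircle.volume_eq_smul_haarAddCircle]; simp

/-- The representative in `(0,1]` of a point of the circle. -/
def pos (s : UnitAddCircle) : ℝ := AddCircle.equivIoc 1 0 s

theorem pos_mem (s : UnitAddCircle) : pos s ∈ Ioc (0 : ℝ) 1 := by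
  have := (AddCircle.equivIoc 1 0 s).2
  exact ⟨this.1, by simpa using! this.2⟩

theorem pos_coe {x : ℝ} (hx : x ∈ Ioc (0 : ℝ) 1) : pos (x : UnitAddCircle) = x := by
  unfold pos
  rw [AddCircle.equivIoc_coe_eq (by rwa [zero_add])]

theorem coe_pos (s : UnitAddCircle) : ((pos s : ℝ) : UnitAddCircle) = s :=
  (AddCircle.equivIoc 1 0).symm_apply_apply s

theorem measurable_pos : Measurable pos :=
  measurable_subtype_coe.comp (AddCircle.measurableEquivIoc 1 0).measurable

theorem measurePreserving_pos : MeasurePreserving pos circMeas (volume.restrict (Ioc 0 1)) := by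
  rw [circMeas_eq_volume]
  have h := (measurePreserving_subtype_coe measurableSet_Ioc).comp
    (AddCircle.measurePreserving_equivIoc 1 (a := 0))
  have e : Ioc (0 : ℝ) (0 + 1) = Ioc 0 1 := by rw [zero_add]
  exact e ▸ h

theorem measurePreserving_coe : MeasurePreserving ((↑) : ℝ → UnitAddCircle)
    (volume.restrict (Ioc 0 1)) circMeas := by
  rw [circMeas_eq_volume]
  simpa using UnitAddCircle.measurePreserving_mk 0

theorem volUnit_eq : volUnit = volume.restrict (Ioc (0 : ℝ) 1) :=
  Measure.restrict_congr_set Ioo_ae_eq_Ioc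

theorem integral_circMeas {E : Type*} [NormedAddCommGroup E] [NormedSpace ℝ E]
    (f : UnitAddCircle → E) : ∫ s, f s ∂circMeas = ∫ x in (0 : ℝ)..1, f x := by
  rw [circMeas_eq_volume, intervalIntegral.integral_of_le zero_le_one]
  simpa using (UnitAddCircle.integral_preimage 0 f).symm


/-! ### Operators and Fourier coefficients on `L_p` of the circle -/

/-- Bounded measurable functions on the circle. -/
def BddMeas (φ : UnitAddCircle → ℂ) : Prop := Measurable φ ∧ ∃ C, ∀ s, ‖φ s‖ ≤ C

section
variable {p : ℝ≥0∞}

theorem BddMeas.memLp_mul {φ : UnitAddCircle → ℂ} (hφ : BddMeas φ) (f : CircLp p) :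
    MemLp (fun s ↦ φ s * f s) p circMeas := by
  obtain ⟨C, hC⟩ := hφ.2
  exact (Lp.memLp f).of_le_mul (hφ.1.aestronglyMeasurable.mul (Lp.aestronglyMeasurable f))
    (ae_of_all _ fun s ↦ by
      rw [norm_mul]
      exact mul_le_mul_of_nonneg_right (hC s) (norm_nonneg _))

theorem MemLp.conj_neg {f : UnitAddCircle → ℂ} (hf : MemLp f p circMeas) :
    MemLp (fun s ↦ starRingEnd ℂ (f (-s))) p circMeas :=
  (hf.comp_measurePreserving (Measure.measurePreserving_neg circMeas)).star

/-- Translation by `t` on `L_p`. -/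
def shiftLp (t : UnitAddCircle) (f : CircLp p) : CircLp p := DomAddAct.mk (-t) +ᵥ f

theorem shiftLp_ae (t : UnitAddCircle) (f : CircLp p) :
    shiftLp t f =ᵐ[circMeas] fun s ↦ f (s - t) := by
  filter_upwards [DomAddAct.vadd_Lp_ae_eq (DomAddAct.mk (-t)) f] with s hs
  rw [shiftLp, hs]
  simp [sub_eq_neg_add]

theorem norm_shiftLp (t : UnitAddCircle) (f : CircLp p) : ‖shiftLp t f‖ = ‖f‖ :=
  DomAddAct.norm_vadd_Lp _ f

theorem shiftLp_add (t : UnitAddCircle) (f g : CircLp p) :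
    shiftLp t (f + g) = shiftLp t f + shiftLp t g :=
  DomAddAct.vadd_Lp_add _ f g

theorem shiftLp_smul (t : UnitAddCircle) (c : ℂ) (f : CircLp p) :
    shiftLp t (c • f) = c • shiftLp t f := by
  apply Lp.ext
  filter_upwards [shiftLp_ae t (c • f), shiftLp_ae t f, Lp.coeFn_smul c (shiftLp t f),
    (measurePreserving_sub_right circMeas t).quasiMeasurePreserving.ae (Lp.coeFn_smul c f)]
    with s h1 h2 h3 h4
  rw [h1, h3, h4]
  simp [h2]

variable [Fact (1 ≤ p)]

theorem CircLp.integrable (f : CircLp p) : Integrable f circMeas :=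
  (Lp.memLp f).integrable Fact.out

theorem CircLp.integral_norm_le (f : CircLp p) : ∫ s, ‖f s‖ ∂circMeas ≤ ‖f‖ := by
  rw [integral_norm_eq_lintegral_enorm (Lp.aestronglyMeasurable f), Lp.norm_def,
    ← eLpNorm_one_eq_lintegral_enorm]
  exact ENNReal.toReal_mono (Lp.eLpNorm_ne_top f)
    (eLpNorm_le_eLpNorm_of_exponent_le Fact.out (Lp.aestronglyMeasurable f))

/-- Multiplication by a bounded measurable function on `L_p`. -/
def mulOp (φ : UnitAddCircle → ℂ) (hφ : BddMeas φ) : CircLp p →L[ℂ] CircLp p :=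
  LinearMap.mkContinuousOfExistsBound
    { toFun := fun f ↦ (hφ.memLp_mul f).toLp _
      map_add' := fun f g ↦ by
        rw [← MemLp.toLp_add]
        refine MemLp.toLp_congr _ _ ?_
        filter_upwards [Lp.coeFn_add f g] with s hs
        rw [Pi.add_apply] at hs ⊢
        rw [hs, mul_add]
      map_smul' := fun c f ↦ by
        rw [← MemLp.toLp_const_smul]
        refine MemLp.toLp_congr _ _ ?_
        filter_upwards [Lp.coeFn_smul c f] with s hs
        rw [Pi.smul_apply] at hs ⊢
        rw [hs, smul_eq_mul, RingHom.id_apply, smul_eq_mul, mul_left_comm] }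
    (by
      obtain ⟨C, hC⟩ := hφ.2
      refine ⟨C, fun f ↦ Lp.norm_le_mul_norm_of_ae_le_mul ?_⟩
      filter_upwards [(hφ.memLp_mul f).coeFn_toLp] with s hs
      simp only [LinearMap.coe_mk, AddHom.coe_mk]
      rw [hs, norm_mul]
      exact mul_le_mul_of_nonneg_right (hC s) (norm_nonneg _))

theorem mulOp_ae {φ : UnitAddCircle → ℂ} (hφ : BddMeas φ) (f : CircLp p) :
    mulOp φ hφ f =ᵐ[circMeas] fun s ↦ φ s * f s :=
  (hφ.memLp_mul f).coeFn_toLp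

theorem norm_mulOp_le {φ : UnitAddCircle → ℂ} (hφ : BddMeas φ) {C : ℝ} (hC : ∀ s, ‖φ s‖ ≤ C)
    (f : CircLp p) : ‖mulOp φ hφ f‖ ≤ C * ‖f‖ := by
  apply Lp.norm_le_mul_norm_of_ae_le_mul
  filter_upwards [mulOp_ae hφ f] with s hs
  rw [hs, norm_mul]
  exact mul_le_mul_of_nonneg_right (hC s) (norm_nonneg _)

/-- Pairing with a bounded measurable function, as a functional on `L_p`. -/
def pairing (φ : UnitAddCircle → ℂ) (hφ : BddMeas φ) : CircLp p →L[ℂ] ℂ :=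
  LinearMap.mkContinuous
    { toFun := fun f ↦ ∫ s, f s ∂circMeas
      map_add' := fun f g ↦ by
        rw [← integral_add (CircLp.integrable f) (CircLp.integrable g)]
        exact integral_congr_ae (Lp.coeFn_add f g)
      map_smul' := fun c f ↦ by
        rw [RingHom.id_apply, ← integral_smul]
        exact integral_congr_ae (Lp.coeFn_smul c f) } 1
    (fun f ↦ by
      rw [one_mul]
      exact (norm_integral_le_integral_norm _).trans (CircLp.integral_norm_le f)) ∘L mulOp φ hφ

theorem pairing_apply {φ : UnitAddCircle → ℂ} (hφ : BddMeas φ) (f : CircLp p) :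
    pairing φ hφ f = ∫ s, φ s * f s ∂circMeas :=
  integral_congr_ae (mulOp_ae hφ f)

theorem norm_pairing_le {φ : UnitAddCircle → ℂ} (hφ : BddMeas φ) {C : ℝ} (hC : ∀ s, ‖φ s‖ ≤ C)
    (f : CircLp p) : ‖pairing φ hφ f‖ ≤ C * ‖f‖ := by
  refine le_trans ?_ (norm_mulOp_le hφ hC f)
  exact (norm_integral_le_integral_norm _).trans (CircLp.integral_norm_le _)

theorem bddMeas_fourier (n : ℤ) : BddMeas (fun s ↦ fourier n s) :=
  ⟨(map_continuous (fourier n)).measurable, 1, fun s ↦ by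
    beta_reduce
    rw [fourier_apply, Circle.norm_coe]⟩

/-- The `n`-th Fourier coefficient as a functional on `L_p`. -/
def fc (n : ℤ) : CircLp p →L[ℂ] ℂ := pairing (fun s ↦ fourier (-n) s) (bddMeas_fourier (-n))

theorem fc_apply (n : ℤ) (f : CircLp p) : fc n f = ∫ s, fourier (-n) s * f s ∂circMeas :=
  pairing_apply _ f

theorem norm_fc_le (n : ℤ) (f : CircLp p) : ‖fc n f‖ ≤ ‖f‖ := by
  have h := norm_pairing_le (bddMeas_fourier (-n)) (C := 1)
    (fun s ↦ by rw [fourier_apply, Circle.norm_coe]) f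
  rwa [one_mul] at h

/-- The real-linear operator `f ↦ conj f(-·)` on `L_p`. -/
def reflConj : CircLp p →L[ℝ] CircLp p :=
  LinearMap.mkContinuous
    { toFun := fun f ↦ (MemLp.conj_neg (Lp.memLp f)).toLp _
      map_add' := fun f g ↦ by
        rw [← MemLp.toLp_add]
        refine MemLp.toLp_congr _ _ ?_
        filter_upwards [(Measure.measurePreserving_neg circMeas).quasiMeasurePreserving.ae
          (Lp.coeFn_add f g)] with s hs
        rw [Pi.add_apply] at hs ⊢
        rw [hs, map_add]
      map_smul' := fun c f ↦ by
        rw [← MemLp.toLp_const_smul]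
        refine MemLp.toLp_congr _ _ ?_
        filter_upwards [(Measure.measurePreserving_neg circMeas).quasiMeasurePreserving.ae
          (Lp.coeFn_smul c f)] with s hs
        rw [Pi.smul_apply] at hs ⊢
        rw [hs]
        simp } 1
    (fun f ↦ by
      simp only [LinearMap.coe_mk, AddHom.coe_mk]
      rw [Lp.norm_toLp, one_mul, Lp.norm_def]
      refine ENNReal.toReal_mono (Lp.eLpNorm_ne_top f) ?_
      rw [← eLpNorm_comp_measurePreserving (Lp.aestronglyMeasurable f)
        (Measure.measurePreserving_neg circMeas)]
      exact eLpNorm_mono fun s ↦ by simp)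

theorem reflConj_ae (f : CircLp p) :
    reflConj f =ᵐ[circMeas] fun s ↦ starRingEnd ℂ (f (-s)) :=
  (MemLp.conj_neg (Lp.memLp f)).coeFn_toLp

theorem norm_reflConj_le (f : CircLp p) : ‖reflConj f‖ ≤ ‖f‖ := by
  simpa using (reflConj (p := p)).le_of_opNorm_le (LinearMap.mkContinuous_norm_le _ zero_le_one _) f

/-- This makes complex conjugation of a coefficient sequence available inside `L_p`, and with it
squared moduli. -/
theorem fc_reflConj (n : ℤ) (f : CircLp p) : fc n (reflConj f) = starRingEnd ℂ (fc n f) := by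
  rw [fc_apply, fc_apply, ← integral_conj, ← integral_neg_eq_self]
  refine integral_congr_ae ?_
  filter_upwards [(Measure.measurePreserving_neg circMeas).quasiMeasurePreserving.ae
    (reflConj_ae f)] with s hs
  rw [hs, neg_neg, map_mul]
  congr 1
  rw [← fourier_neg, neg_neg, fourier_apply, fourier_apply]
  simp

theorem fc_shiftLp (n : ℤ) (t : UnitAddCircle) (f : CircLp p) :
    fc n (shiftLp t f) = fourier (-n) t * fc n f := by
  rw [fc_apply, fc_apply, ← integral_const_mul,
    ← integral_sub_right_eq_self (fun s ↦ fourier (-n) t * (fourier (-n) s * f s)) t]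
  refine integral_congr_ae ?_
  filter_upwards [shiftLp_ae t f] with s hs
  rw [hs, ← mul_assoc]
  congr 1
  rw [fourier_apply, fourier_apply, fourier_apply, ← Circle.coe_mul, ← AddCircle.toCircle_add,
    ← smul_add, add_sub_cancel]

theorem pairing_shiftLp_reflConj {φ φ' : UnitAddCircle → ℂ} (hφ : BddMeas φ) (hφ' : BddMeas φ')
    (t : UnitAddCircle) (h : ∀ s, φ' s = starRingEnd ℂ (φ (t - s))) (f : CircLp p) :
    pairing φ hφ (shiftLp t (reflConj f)) = starRingEnd ℂ (pairing φ' hφ' f) := by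
  rw [pairing_apply, pairing_apply, ← integral_conj,
    ← integral_sub_left_eq_self (fun s ↦ starRingEnd ℂ (φ' s * f s)) circMeas t]
  refine integral_congr_ae ?_
  filter_upwards [shiftLp_ae t (reflConj f),
    (measurePreserving_sub_right circMeas t).quasiMeasurePreserving.ae (reflConj_ae f)]
    with s h1 h2
  rw [h1, h2, h]
  simp

theorem fc_fourierLp (n m : ℤ) :
    fc n (fourierLp (T := 1) p m) = if n = m then 1 else 0 := by
  have h1 : fc n (fourierLp (T := 1) p m) = fourierCoeff (fourier (T := 1) m) n := by
    rw [fc_apply, fourierCoeff]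
    refine integral_congr_ae ?_
    filter_upwards [coeFn_fourierLp (T := 1) p m] with s hs
    rw [hs, smul_eq_mul]
  rw [h1, fourierCoeff_fourier, Pi.single_apply]

/-- Adding a trigonometric polynomial prescribes finitely many coefficients at will, so later
constructions need only succeed for all but finitely many `n`. -/
theorem exists_fc_eq_of_finite (x : ℤ → ℂ) (f : CircLp p) (s : Finset ℤ)
    (h : ∀ n ∉ s, x n = fc n f) : ∃ g : CircLp p, ∀ n, fc n g = x n := by
  refine ⟨f + ∑ m ∈ s, (x m - fc m f) • fourierLp (T := 1) p m, fun n ↦ ?_⟩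
  simp only [map_add, map_sum, map_smul, fc_fourierLp, smul_eq_mul, mul_ite, mul_one, mul_zero]
  rw [Finset.sum_ite_eq]
  split_ifs with hn
  · ring
  · rw [h n hn, add_zero]

/-! ### Convolution and trigonometric approximation -/

variable [Fact (p ≠ ∞)]

theorem continuous_shiftLp : Continuous fun x : UnitAddCircle × CircLp p ↦ shiftLp x.1 x.2 :=
  Continuous.vadd (DomAddAct.continuous_mk.comp continuous_fst.neg) continuous_snd

theorem integrable_smul_shiftLp (f g : CircLp p) :
    Integrable (fun t ↦ f t • shiftLp t g) circMeas := by
  refine (CircLp.integrable f).smul_bdd ‖g‖ ?_ (ae_of_all _ fun t ↦ (norm_shiftLp t g).le)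
  exact (continuous_shiftLp.comp (continuous_id.prodMk continuous_const)).aestronglyMeasurable

/-- Convolution on `L_p` of the circle. -/
def conv : CircLp p →L[ℂ] CircLp p →L[ℂ] CircLp p :=
  LinearMap.mkContinuous₂
    (LinearMap.mk₂ ℂ (fun f g : CircLp p ↦ ∫ t, f t • shiftLp t g ∂circMeas)
      (fun f₁ f₂ g ↦ by
        rw [← integral_add (integrable_smul_shiftLp f₁ g) (integrable_smul_shiftLp f₂ g)]
        refine integral_congr_ae ?_
        filter_upwards [Lp.coeFn_add f₁ f₂] with s hs
        rw [hs, Pi.add_apply, add_smul])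
      (fun c f g ↦ by
        rw [← integral_smul]
        refine integral_congr_ae ?_
        filter_upwards [Lp.coeFn_smul c f] with s hs
        rw [hs, Pi.smul_apply, smul_assoc])
      (fun f g₁ g₂ ↦ by
        rw [← integral_add (integrable_smul_shiftLp f g₁) (integrable_smul_shiftLp f g₂)]
        simp only [shiftLp_add, smul_add])
      (fun c f g ↦ by
        rw [← integral_smul]
        simp only [shiftLp_smul, smul_comm c])) 1
    (fun f g ↦ by
      rw [one_mul, LinearMap.mk₂_apply]
      refine (norm_integral_le_integral_norm _).trans ?_
      simp only [norm_smul, norm_shiftLp]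
      rw [integral_mul_const]
      exact mul_le_mul_of_nonneg_right (CircLp.integral_norm_le f) (norm_nonneg _))

theorem conv_apply (f g : CircLp p) : conv f g = ∫ t, f t • shiftLp t g ∂circMeas := rfl

theorem norm_conv_le (f : CircLp p) : ‖conv f‖ ≤ ‖f‖ := by
  have : ‖(conv : CircLp p →L[ℂ] _)‖ ≤ 1 := LinearMap.mkContinuous₂_norm_le _ zero_le_one _
  simpa using (conv (p := p)).le_of_opNorm_le this f

theorem fc_conv (n : ℤ) (f g : CircLp p) : fc n (conv f g) = fc n f * fc n g := by
  rw [conv_apply, ← (fc n).integral_comp_comm (integrable_smul_shiftLp f g), fc_apply n f,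
    ← integral_mul_const]
  refine integral_congr_ae (ae_of_all _ fun t ↦ ?_)
  simp only [map_smul, fc_shiftLp, smul_eq_mul]
  ring

/-- Subtracting a trigonometric polynomial close to `f` makes the norm small; density of these
polynomials in `L_p` is where `p ≠ ∞` enters. -/
theorem exists_trigPoly (f : CircLp p) {ε : ℝ} (hε : 0 < ε) :
    ∃ (s : Finset ℤ) (g : CircLp p), ‖g‖ < ε ∧ ∀ n ∉ s, fc n g = fc n f := by
  have hd : f ∈ closure (Submodule.span ℂ (range (fourierLp (T := 1) p)) : Set (CircLp p)) := by
    rw [← Submodule.topologicalClosure_coe, span_fourierLp_closure_eq_top Fact.out]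
    trivial
  obtain ⟨P, hP, hfP⟩ := Metric.mem_closure_iff.1 hd ε hε
  obtain ⟨c, rfl⟩ := Finsupp.mem_span_range_iff_exists_finsupp.1 hP
  refine ⟨c.support, f - c.sum fun i a ↦ a • fourierLp p i, by rwa [← dist_eq_norm], ?_⟩
  intro n hn
  rw [map_sub, Finsupp.sum, map_sum, Finset.sum_eq_zero, sub_zero]
  intro m hm
  have hnm : n ≠ m := by rintro rfl; exact hn hm
  rw [map_smul, fc_fourierLp, if_neg hnm, smul_zero]

end

/-! ### Analytic functional calculus modulo finitely many Fourier coefficients -/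

section Contraction

theorem norm_pow_sub_pow_le {A : Type*} [NormedRing A] [NormOneClass A] {a b : A} {R : ℝ}
    (hR : 0 ≤ R) (ha : ‖a‖ ≤ R) (hb : ‖b‖ ≤ R) (k : ℕ) :
    ‖a ^ (k + 1) - b ^ (k + 1)‖ ≤ (k + 1) * R ^ k * ‖a - b‖ := by
  induction k with
  | zero => simp
  | succ k ih =>
    have e : a ^ (k + 1 + 1) - b ^ (k + 1 + 1)
        = a * (a ^ (k + 1) - b ^ (k + 1)) + (a - b) * b ^ (k + 1) := by
      rw [pow_succ' a (k + 1), pow_succ' b (k + 1)]; noncomm_ring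
    rw [e]
    calc _ ≤ ‖a‖ * ‖a ^ (k + 1) - b ^ (k + 1)‖ + ‖a - b‖ * ‖b‖ ^ (k + 1) := by
          refine (norm_add_le _ _).trans (add_le_add (norm_mul_le _ _) ?_)
          exact (norm_mul_le _ _).trans
            (mul_le_mul_of_nonneg_left (norm_pow_le _ _) (norm_nonneg _))
      _ ≤ R * ((k + 1) * R ^ k * ‖a - b‖) + ‖a - b‖ * R ^ (k + 1) := by gcongr
      _ = _ := by push_cast; ring

variable {E : Type*} [NormedAddCommGroup E] [NormedSpace ℂ E]

/-- The coefficients of `(exp x - 1 - x) / x`. -/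
def expTail (k : ℕ) : ℂ := if k = 0 then 0 else ((k + 1).factorial : ℂ)⁻¹

/-- The terms of the power series whose fixed points `f` solve `exp f - 1 = ∑ fᵏ Cₖ`. -/
def fixTerm (L : E →L[ℂ] E →L[ℂ] E) (C : ℕ → E) (f : E) (k : ℕ) : E :=
  (L f ^ k) (C k - expTail k • f)

theorem norm_expTail_succ (k : ℕ) : ‖expTail (k + 1)‖ = ((k + 2).factorial : ℝ)⁻¹ := by
  simp [expTail]

/-- `L` abstracts a multiplication, so that one estimate serves both convolution on `L_p` and
multiplication on `ℂ`. On the ball of radius `1/4` the powers absorb the factor `k + 1`, and the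
factorial in `expTail` absorbs `k + 2`. -/
theorem norm_fixTerm_sub_le [Nontrivial E] {L : E →L[ℂ] E →L[ℂ] E} (hL : ∀ f, ‖L f‖ ≤ ‖f‖)
    (C : ℕ → E) {f g : E} (hf : ‖f‖ ≤ 1 / 4) (hg : ‖g‖ ≤ 1 / 4) (k : ℕ) :
    ‖fixTerm L C f (k + 1) - fixTerm L C g (k + 1)‖
      ≤ (‖C (k + 1)‖ + (1 / 4) * (1 / 4) ^ k) * ‖f - g‖ := by
  have e : fixTerm L C f (k + 1) - fixTerm L C g (k + 1)
      = (L f ^ (k + 1) - L g ^ (k + 1)) (C (k + 1) - expTail (k + 1) • f)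
        - (L g ^ (k + 1)) (expTail (k + 1) • (f - g)) := by
    simp only [fixTerm, map_sub, sub_apply, smul_sub]
    abel
  have h1 : ‖L f ^ (k + 1) - L g ^ (k + 1)‖ ≤ (k + 1) * (1 / 4) ^ k * ‖f - g‖ := by
    refine (norm_pow_sub_pow_le (by norm_num) ((hL f).trans hf) ((hL g).trans hg) k).trans ?_
    rw [← map_sub]
    gcongr
    exact hL _
  have h2 : ‖L g ^ (k + 1)‖ ≤ (1 / 4) ^ (k + 1) :=
    (norm_pow_le _ _).trans (pow_le_pow_left₀ (norm_nonneg _) ((hL g).trans hg) _)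
  -- Bernoulli's inequality: `4 ^ k ≥ 1 + 3 k ≥ k + 1`.
  have h3 : (k + 1 : ℝ) * (1 / 4) ^ k ≤ 1 := by
    rw [one_div, inv_pow, ← div_eq_mul_inv, div_le_one (by positivity)]
    have := one_add_mul_le_pow (a := (3 : ℝ)) (by norm_num) k
    norm_num at this
    linarith [Nat.cast_nonneg (α := ℝ) k]
  have hb : ((k + 2 : ℕ) : ℝ) * ‖expTail (k + 1)‖ ≤ 1 := by
    rw [norm_expTail_succ, ← div_eq_mul_inv, div_le_one (by positivity)]
    exact_mod_cast Nat.self_le_factorial _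
  rw [e]
  calc _ ≤ ‖L f ^ (k + 1) - L g ^ (k + 1)‖ * (‖C (k + 1)‖ + ‖expTail (k + 1)‖ * ‖f‖)
        + ‖L g ^ (k + 1)‖ * (‖expTail (k + 1)‖ * ‖f - g‖) := by
        refine (norm_sub_le _ _).trans (add_le_add ?_ ?_)
        · refine (ContinuousLinearMap.le_opNorm _ _).trans ?_
          gcongr
          exact (norm_sub_le _ _).trans (by rw [norm_smul])
        · exact (ContinuousLinearMap.le_opNorm _ _).trans (by rw [norm_smul])
    _ ≤ ((k + 1) * (1 / 4) ^ k * ‖f - g‖) * (‖C (k + 1)‖ + ‖expTail (k + 1)‖ * (1 / 4))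
        + (1 / 4) ^ (k + 1) * (‖expTail (k + 1)‖ * ‖f - g‖) := by gcongr
    _ = ((k + 1) * (1 / 4) ^ k * ‖C (k + 1)‖
        + (1 / 4) * (1 / 4) ^ k * (((k + 2 : ℕ) : ℝ) * ‖expTail (k + 1)‖)) * ‖f - g‖ := by
        push_cast; ring
    _ ≤ (1 * ‖C (k + 1)‖ + (1 / 4) * (1 / 4) ^ k * 1) * ‖f - g‖ := by gcongr
    _ = _ := by ring

theorem fixTerm_zero_right (L : E →L[ℂ] E →L[ℂ] E) (C : ℕ → E) (k : ℕ) :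
    fixTerm L C 0 (k + 1) = 0 := by
  simp [fixTerm]

theorem fixTerm_zero (L : E →L[ℂ] E →L[ℂ] E) (C : ℕ → E) (f : E) :
    fixTerm L C f 0 = C 0 := by
  simp [fixTerm, expTail]

theorem hasSum_quarter_pow : HasSum (fun k : ℕ ↦ (1 / 4 : ℝ) * (1 / 4) ^ k) (1 / 3) := by
  have := (hasSum_geometric_of_lt_one (r := (1 / 4 : ℝ)) (by norm_num) (by norm_num)).mul_left
    (1 / 4 : ℝ)
  norm_num at this ⊢
  exact this

variable [CompleteSpace E] [Nontrivial E]

theorem summable_fixTerm {L : E →L[ℂ] E →L[ℂ] E} (hL : ∀ f, ‖L f‖ ≤ ‖f‖)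
    {C : ℕ → E} (hC : Summable fun k ↦ ‖C k‖) {f : E} (hf : ‖f‖ ≤ 1 / 4) :
    Summable (fixTerm L C f) := by
  rw [← summable_nat_add_iff 1]
  refine Summable.of_norm_bounded (g := fun k ↦ (‖C (k + 1)‖ + (1 / 4) * (1 / 4) ^ k) * ‖f‖)
    ((((summable_nat_add_iff 1).2 hC).add hasSum_quarter_pow.summable).mul_right _) fun k ↦ ?_
  have := norm_fixTerm_sub_le hL C hf (g := 0) (by simp) k
  rwa [fixTerm_zero_right, sub_zero, sub_zero] at this

/-- The Lipschitz constant is at most `1/8` from the `C k` plus `1/3` from the geometric series,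
which is below `1/2`. The term `k = 0` does not depend on `f`. -/
theorem norm_tsum_fixTerm_sub_le {L : E →L[ℂ] E →L[ℂ] E} (hL : ∀ f, ‖L f‖ ≤ ‖f‖)
    {C : ℕ → E} (hC : Summable fun k ↦ ‖C k‖) (hC' : ∑' k, ‖C k‖ ≤ 1 / 8)
    {f g : E} (hf : ‖f‖ ≤ 1 / 4) (hg : ‖g‖ ≤ 1 / 4) :
    ‖∑' k, fixTerm L C f k - ∑' k, fixTerm L C g k‖ ≤ 1 / 2 * ‖f - g‖ := by
  have hsf := summable_fixTerm hL hC hf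
  have hsg := summable_fixTerm hL hC hg
  rw [hsf.tsum_eq_zero_add, hsg.tsum_eq_zero_add, fixTerm_zero, fixTerm_zero,
    add_sub_add_left_eq_sub, ← ((summable_nat_add_iff 1).2 hsf).tsum_sub
    ((summable_nat_add_iff 1).2 hsg)]
  have hs := (((summable_nat_add_iff 1).2 hC).hasSum.add hasSum_quarter_pow).mul_right ‖f - g‖
  refine (tsum_of_norm_bounded hs fun k ↦ norm_fixTerm_sub_le hL C hf hg k).trans ?_
  have h0 := hC.tsum_eq_zero_add
  gcongr
  linarith [norm_nonneg (C 0)]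

/-- The map sends `0` to `C 0`, of norm at most `1/8`, and is `1/2`-Lipschitz, so it preserves the
ball of radius `1/4`; Banach's theorem applies there. -/
theorem exists_fixTerm_fixedPoint {L : E →L[ℂ] E →L[ℂ] E} (hL : ∀ f, ‖L f‖ ≤ ‖f‖)
    {C : ℕ → E} (hC : Summable fun k ↦ ‖C k‖) (hC' : ∑' k, ‖C k‖ ≤ 1 / 8) :
    ∃ f : E, ‖f‖ ≤ 1 / 4 ∧ ∑' k, fixTerm L C f k = f := by
  set T : E → E := fun f ↦ ∑' k, fixTerm L C f k with hT
  have h0 : ‖T 0‖ ≤ 1 / 8 := by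
    have : T 0 = C 0 := by
      rw [hT]
      beta_reduce
      rw [tsum_eq_single 0, fixTerm_zero]
      intro k hk
      obtain ⟨m, rfl⟩ := Nat.exists_eq_succ_of_ne_zero hk
      exact fixTerm_zero_right L C m
    rw [this]
    exact (hC.le_tsum 0 fun _ _ ↦ norm_nonneg _).trans hC'
  have hmaps : MapsTo T (Metric.closedBall 0 (1 / 4)) (Metric.closedBall 0 (1 / 4)) := by
    intro f hf
    rw [mem_closedBall_zero_iff] at hf ⊢
    have h1 := norm_tsum_fixTerm_sub_le hL hC hC' hf (g := 0) (by simp)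
    rw [sub_zero] at h1
    have h2 : ‖T f‖ ≤ ‖T f - T 0‖ + ‖T 0‖ := by
      simpa using norm_add_le (T f - T 0) (T 0)
    change ‖T f - T 0‖ ≤ _ at h1
    linarith
  have hcontr : ContractingWith (1 / 2) (hmaps.restrict T _ _) := by
    refine ⟨by norm_num [← NNReal.coe_lt_coe], LipschitzWith.of_dist_le_mul fun f g ↦ ?_⟩
    have hf := mem_closedBall_zero_iff.1 f.2
    have hg := mem_closedBall_zero_iff.1 g.2
    have := norm_tsum_fixTerm_sub_le hL hC hC' hf hg
    rw [Subtype.dist_eq, Subtype.dist_eq, dist_eq_norm, dist_eq_norm]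
    simpa using this
  obtain ⟨f, hf, hfix, -⟩ := hcontr.exists_fixedPoint' Metric.isClosed_closedBall.isComplete
    hmaps (x := 0) (by simp) (by finiteness)
  exact ⟨f, mem_closedBall_zero_iff.1 hf, hfix⟩

end Contraction

/-! ### The scalar version of the fixed-point equation -/

section Scalar

theorem hasSum_expTail (x : ℂ) :
    HasSum (fun k ↦ x ^ k * (expTail k * x)) (Complex.exp x - 1 - x) := by
  have h := NormedSpace.expSeries_div_hasSum_exp x
  rw [← Complex.exp_eq_exp_ℂ] at h
  have h1 := (hasSum_nat_add_iff' 1).2 h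
  have h2 := (hasSum_nat_add_iff' 1).2 h1
  rw [← hasSum_nat_add_iff' 1]
  convert! h2 using 1
  · funext k
    simp only [expTail]
    rw [if_neg (Nat.succ_ne_zero k)]
    field_simp
    ring
  · simp [expTail]

theorem fixTerm_mul (c : ℕ → ℂ) (x : ℂ) (k : ℕ) :
    fixTerm (ContinuousLinearMap.mul ℂ ℂ) c x k = x ^ k * (c k - expTail k * x) := by
  rw [fixTerm, smul_eq_mul]
  generalize c k - expTail k * x = y
  induction k with
  | zero => simp
  | succ k ih => 
    rw [pow_succ']
    change x * ((ContinuousLinearMap.mul ℂ ℂ x ^ k) y) = _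
    rw [ih, pow_succ', mul_assoc]

/-- The `expTail` part sums to `exp x - 1 - x`, so the exponential equation is exactly the
fixed-point equation. -/
theorem tsum_fixTerm_mul_eq {c : ℕ → ℂ} {x : ℂ} (hc : Summable fun k ↦ x ^ k * c k)
    (h : Complex.exp x - 1 = ∑' k, x ^ k * c k) :
    ∑' k, fixTerm (ContinuousLinearMap.mul ℂ ℂ) c x k = x := by
  simp only [fixTerm_mul, mul_sub]
  rw [hc.tsum_sub (hasSum_expTail x).summable, ← h, (hasSum_expTail x).tsum_eq]
  ring

end Scalar

/-! ### Solving equations in the convolution algebra -/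

section Circle

variable {p : ℝ≥0∞} [Fact (1 ≤ p)] [Fact (p ≠ ∞)]

theorem fc_conv_pow (n : ℤ) (f u : CircLp p) (k : ℕ) :
    fc n ((conv f ^ k) u) = fc n f ^ k * fc n u := by
  induction k with
  | zero => simp
  | succ k ih =>
    rw [pow_succ']
    change fc n (conv f ((conv f ^ k) u)) = _
    rw [fc_conv, ih, pow_succ', mul_assoc]

instance : Nontrivial (CircLp p) := by
  refine ⟨⟨fourierLp (T := 1) p 0, 0, fun h ↦ ?_⟩⟩
  have := fc_fourierLp (p := p) 0 0
  rw [h] at this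
  simp at this

/-- A tail of the series is already small; each of the finitely many remaining terms is made small
by dropping a trigonometric polynomial. -/
theorem exists_small_modification {C : ℕ → CircLp p} (hC : Summable fun k ↦ ‖C k‖) {η : ℝ}
    (hη : 0 < η) : ∃ (s : Finset ℤ) (C' : ℕ → CircLp p), (Summable fun k ↦ ‖C' k‖) ∧
      ∑' k, ‖C' k‖ ≤ η ∧ ∀ n ∉ s, ∀ k, fc n (C' k) = fc n (C k) := by
  have ht := tendsto_sum_nat_add fun k ↦ ‖C k‖
  obtain ⟨N, hN⟩ := ((tendsto_order.1 ht).2 (η / 2) (by positivity)).exists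
  choose s g hg hs using fun k ↦ exists_trigPoly (C k) (ε := η / (2 * (N + 1))) (by positivity)
  set C' : ℕ → CircLp p := fun k ↦ if k < N then g k else C k with hC'
  have htail : ∀ k, C' (k + N) = C (k + N) := fun k ↦ by simp [hC']
  have hsum : Summable fun k ↦ ‖C' k‖ := by
    rw [← summable_nat_add_iff N]
    simp only [htail]
    exact (summable_nat_add_iff N).2 hC
  refine ⟨(Finset.range N).biUnion s, C', hsum, ?_, fun n hn k ↦ ?_⟩
  · rw [← hsum.sum_add_tsum_nat_add N]
    simp only [htail]
    have : ∑ k ∈ Finset.range N, ‖C' k‖ ≤ ∑ k ∈ Finset.range N, η / (2 * (N + 1)) := by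
      refine Finset.sum_le_sum fun k hk ↦ ?_
      simp only [hC', if_pos (Finset.mem_range.1 hk)]
      exact (hg k).le
    have h2 : ∑ k ∈ Finset.range N, η / (2 * (N + 1)) ≤ η / 2 := by
      rw [Finset.sum_const, Finset.card_range, nsmul_eq_mul, mul_div_assoc', div_le_div_iff₀
        (by positivity) (by positivity)]
      nlinarith
    linarith
  · simp only [hC']
    split_ifs with hk
    · refine hs k n fun h ↦ hn ?_
      exact Finset.mem_biUnion.2 ⟨k, Finset.mem_range.2 hk, h⟩
    · rfl

/-- Since `fc n` is continuous and multiplicative, it carries the fixed point in `L_p` to a fixed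
point of the scalar map with coefficients `fc n (C' k)`. For almost all `n` the number `X n` is
another one in the same ball, and a contraction has only one. The exceptions are the modified
frequencies and those with `X n` outside the ball. -/
theorem exists_fc_eq_of_exp_eq {C : ℕ → CircLp p} (hC : Summable fun k ↦ ‖C k‖) {X : ℤ → ℂ}
    (hX : Tendsto X cofinite (𝓝 0))
    (h : ∀ n, Complex.exp (X n) - 1 = ∑' k, X n ^ k * fc n (C k)) :
    ∃ f : CircLp p, ∀ n, fc n f = X n := by
  obtain ⟨s, C', hC', hη, hs⟩ := exists_small_modification hC (η := 1 / 8) (by norm_num)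
  obtain ⟨f, hf, hfix⟩ := exists_fixTerm_fixedPoint (L := conv) norm_conv_le hC' hη
  have hsmall : {n | ¬ ‖X n‖ ≤ 1 / 4}.Finite := by
    refine Filter.eventually_cofinite.1 ?_
    filter_upwards [hX.eventually (Metric.closedBall_mem_nhds (0 : ℂ) (ε := 1 / 4) (by norm_num))]
      with n hn using mem_closedBall_zero_iff.1 hn
  refine exists_fc_eq_of_finite X f (s ∪ hsmall.toFinset) fun n hn ↦ ?_
  simp only [Finset.mem_union, Finite.mem_toFinset, mem_ofPred_eq, not_or, not_not] at hn
  set c : ℕ → ℂ := fun k ↦ fc n (C' k)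
  have hcle : ∀ k, ‖c k‖ ≤ ‖C' k‖ := fun k ↦ norm_fc_le n _
  have hcs : Summable fun k ↦ ‖c k‖ := hC'.of_nonneg_of_le (fun _ ↦ norm_nonneg _) hcle
  have hc8 : ∑' k, ‖c k‖ ≤ 1 / 8 := (hcs.tsum_le_tsum hcle hC').trans hη
  have hmul : ∀ x : ℂ, ‖ContinuousLinearMap.mul ℂ ℂ x‖ ≤ ‖x‖ := fun x ↦
    ContinuousLinearMap.opNorm_mul_apply_le ℂ ℂ x
  have h1 : ∑' k, fixTerm (ContinuousLinearMap.mul ℂ ℂ) c (fc n f) k = fc n f := by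
    have hsm := summable_fixTerm (L := conv) norm_conv_le hC' hf
    conv_rhs => rw [← hfix, (fc n).map_tsum hsm]
    refine tsum_congr fun k ↦ ?_
    rw [fixTerm_mul, fixTerm, fc_conv_pow, map_sub, map_smul, smul_eq_mul]
  have h2 : ∑' k, fixTerm (ContinuousLinearMap.mul ℂ ℂ) c (X n) k = X n := by
    apply tsum_fixTerm_mul_eq
    · refine Summable.of_norm_bounded hcs fun k ↦ ?_
      rw [norm_mul, norm_pow]
      exact mul_le_of_le_one_left (norm_nonneg _) (pow_le_one₀ (norm_nonneg _)
        (hn.2.trans (by norm_num)))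
    · rw [h n]
      exact tsum_congr fun k ↦ by rw [← hs n hn.1 k]
  have h3 := norm_tsum_fixTerm_sub_le hmul hcs hc8 hn.2 ((norm_fc_le n f).trans hf)
  rw [h1, h2] at h3
  have : ‖X n - fc n f‖ = 0 := by linarith [norm_nonneg (X n - fc n f)]
  exact sub_eq_zero.1 (norm_eq_zero.1 this)

/-- After removing a trigonometric polynomial, `1 + conv y'` is inverted by a Neumann series. The
solution of `u + y' * u = -y'` has coefficients `-y/(1+y) = 1/(1+y) - 1` off a finite set, and the
rest are prescribed. -/
theorem exists_fc_eq_inv (y : CircLp p) (hy : ∀ n, 1 + fc n y ≠ 0) :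
    ∃ g : CircLp p, ∀ n, fc n g = (1 + fc n y)⁻¹ - 1 := by
  obtain ⟨s, y', hy', hs⟩ := exists_trigPoly y (ε := 1) one_pos
  have hL : ‖-conv y'‖ < 1 := by rw [norm_neg]; exact (norm_conv_le y').trans_lt hy'
  set U := Units.oneSub (-conv y') hL with hU
  set u : CircLp p := (↑U⁻¹ : CircLp p →L[ℂ] CircLp p) (-y') with hu
  have hUu : u + conv y' u = -y' := by
    have h1 : (U : CircLp p →L[ℂ] CircLp p) u = -y' := by
      change ((U : CircLp p →L[ℂ] CircLp p) * (↑U⁻¹ : CircLp p →L[ℂ] CircLp p)) (-y') = -y'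
      rw [Units.mul_inv]; rfl
    rw [← h1, hU, Units.val_oneSub]
    simp
  refine exists_fc_eq_of_finite _ u s fun n hn ↦ ?_
  have h2 := congrArg (fc n) hUu
  rw [map_add, fc_conv, map_neg, hs n hn] at h2
  have := hy n
  field_simp
  linear_combination (-1 : ℂ) * h2


/-! ### Substituting a Fourier coefficient into an exponential -/

/-- The functions `σᵏ / k! * ψ`. -/
def expCoef (σ ψ : UnitAddCircle → ℂ) (k : ℕ) (s : UnitAddCircle) : ℂ :=
  σ s ^ k / k.factorial * ψ s

theorem norm_expCoef_le {σ ψ : UnitAddCircle → ℂ} (hσ : ∀ s, ‖σ s‖ ≤ 1) (hψ : ∀ s, ‖ψ s‖ ≤ 1)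
    (k : ℕ) (s : UnitAddCircle) : ‖expCoef σ ψ k s‖ ≤ ((k.factorial : ℝ))⁻¹ := by
  rw [expCoef, norm_mul, norm_div, norm_pow, Complex.norm_natCast, div_mul_eq_mul_div,
    div_eq_mul_inv]
  exact mul_le_of_le_one_left (by positivity)
    (mul_le_one₀ (pow_le_one₀ (norm_nonneg _) (hσ s)) (norm_nonneg _) (hψ s))

theorem bddMeas_expCoef {σ ψ : UnitAddCircle → ℂ} (mσ : Measurable σ) (hσ : ∀ s, ‖σ s‖ ≤ 1)
    (mψ : Measurable ψ) (hψ : ∀ s, ‖ψ s‖ ≤ 1) (k : ℕ) : BddMeas (expCoef σ ψ k) :=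
  ⟨((mσ.pow_const k).div_const _).mul mψ, _, norm_expCoef_le hσ hψ k⟩

section Subst

variable {σ ψ : UnitAddCircle → ℂ} (mσ : Measurable σ) (hσ : ∀ s, ‖σ s‖ ≤ 1) (mψ : Measurable ψ)
  (hψ : ∀ s, ‖ψ s‖ ≤ 1)

omit [Fact (p ≠ ∞)] in
theorem norm_mulOp_expCoef_le (k : ℕ) (F : CircLp p) :
    ‖mulOp _ (bddMeas_expCoef mσ hσ mψ hψ k) F‖ ≤ ((k.factorial : ℝ))⁻¹ * ‖F‖ :=
  norm_mulOp_le _ (norm_expCoef_le hσ hψ k) F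

omit [Fact (p ≠ ∞)] in
-- Expanding `exp (x σ)` and integrating termwise moves the dependence on `x` into powers, leaving
-- Fourier coefficients of fixed `L_p` functions.
theorem hasSum_fc_mulOp_expCoef (F : CircLp p) (n : ℤ) (x : ℂ) :
    HasSum (fun k ↦ x ^ k * fc n (mulOp _ (bddMeas_expCoef mσ hσ mψ hψ k) F))
      (∫ s, fourier (-n) s * (Complex.exp (x * σ s) * ψ s * F s) ∂circMeas) := by
  have hterm : ∀ k, x ^ k * fc n (mulOp _ (bddMeas_expCoef mσ hσ mψ hψ k) F)
      = ∫ s, fourier (-n) s * (x ^ k * expCoef σ ψ k s * F s) ∂circMeas := by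
    intro k
    rw [fc_apply, ← integral_const_mul]
    refine integral_congr_ae ?_
    filter_upwards [mulOp_ae (bddMeas_expCoef mσ hσ mψ hψ k) F] with s hs
    rw [hs]; ring
  simp only [hterm]
  have hsumE : ∀ s, HasSum (fun k ↦ fourier (-n) s * (x ^ k * expCoef σ ψ k s * F s))
      (fourier (-n) s * (Complex.exp (x * σ s) * ψ s * F s)) := by
    intro s
    have h := NormedSpace.expSeries_div_hasSum_exp (x * σ s)
    rw [← Complex.exp_eq_exp_ℂ] at h
    convert! ((h.mul_right (ψ s)).mul_right (F s)).mul_left (fourier (-n) s) using 3 with k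
    rw [expCoef, mul_pow]
    ring
  have hb : ∀ k s, ‖fourier (-n) s * (x ^ k * expCoef σ ψ k s * F s)‖
      ≤ ‖x‖ ^ k / k.factorial * ‖F s‖ := by
    intro k s
    rw [norm_mul, norm_mul, norm_mul, norm_pow, fourier_apply, Circle.norm_coe, one_mul,
      div_eq_mul_inv]
    gcongr
    exact norm_expCoef_le hσ hψ k s
  have hmeas : ∀ k, AEStronglyMeasurable
      (fun s ↦ fourier (-n) s * (x ^ k * expCoef σ ψ k s * F s)) circMeas := fun k ↦
    (bddMeas_fourier (-n)).1.aestronglyMeasurable.mul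
      (((bddMeas_expCoef mσ hσ mψ hψ k).1.aestronglyMeasurable.const_mul _).mul
        (Lp.aestronglyMeasurable F))
  have hint : ∀ k, Integrable
      (fun s ↦ fourier (-n) s * (x ^ k * expCoef σ ψ k s * F s)) circMeas := fun k ↦
    ((CircLp.integrable F).norm.const_mul _).mono' (hmeas k) (ae_of_all _ (hb k))
  have hmain := hasSum_integral_of_summable_integral_norm hint (by
    refine Summable.of_nonneg_of_le (fun _ ↦ integral_nonneg fun _ ↦ norm_nonneg _) (fun k ↦ ?_)
      ((Real.summable_pow_div_factorial ‖x‖).mul_right (∫ s, ‖F s‖ ∂circMeas))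
    rw [← integral_const_mul]
    exact integral_mono (hint k).norm ((CircLp.integrable F).norm.const_mul _) (hb k))
  simpa only [fun s ↦ (hsumE s).tsum_eq] using hmain

/-- The terms of the exponential series of operators `∑ (conv f)ᵏ ∘ (σᵏ / k! * ψ)`. -/
def substTerm (f : CircLp p) (k : ℕ) : CircLp p →L[ℂ] CircLp p :=
  (conv f ^ k).comp (mulOp _ (bddMeas_expCoef mσ hσ mψ hψ k))

theorem norm_substTerm_le (f : CircLp p) (k : ℕ) :
    ‖substTerm mσ hσ mψ hψ f k‖ ≤ ‖f‖ ^ k / k.factorial := by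
  rw [div_eq_mul_inv]
  refine (ContinuousLinearMap.opNorm_comp_le _ _).trans
    (mul_le_mul ?_ ?_ (norm_nonneg _) (by positivity))
  · exact (norm_pow_le _ _).trans (pow_le_pow_left₀ (norm_nonneg _) (norm_conv_le f) k)
  · exact ContinuousLinearMap.opNorm_le_bound _ (by positivity)
      (norm_mulOp_expCoef_le mσ hσ mψ hψ k)

theorem fc_substTerm (f F : CircLp p) (n : ℤ) (k : ℕ) :
    fc n (substTerm mσ hσ mψ hψ f k F)
      = fc n f ^ k * fc n (mulOp _ (bddMeas_expCoef mσ hσ mψ hψ k) F) :=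
  fc_conv_pow n f _ k

/-- The operator on `L_p` whose effect on Fourier coefficients is to insert the factor
`exp (fc n f * σ) * ψ` under the integral. -/
def substOp (f : CircLp p) : CircLp p →L[ℂ] CircLp p := ∑' k, substTerm mσ hσ mψ hψ f k

theorem fc_substOp (f F : CircLp p) (n : ℤ) :
    fc n (substOp mσ hσ mψ hψ f F)
      = ∫ s, fourier (-n) s * (Complex.exp (fc n f * σ s) * ψ s * F s) ∂circMeas := by
  have hsum : Summable (substTerm mσ hσ mψ hψ f) :=
    Summable.of_norm_bounded (Real.summable_pow_div_factorial ‖f‖) (norm_substTerm_le mσ hσ mψ hψ f)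
  have h1 : HasSum (fun k ↦ fc n (substTerm mσ hσ mψ hψ f k F))
      (fc n (substOp mσ hσ mψ hψ f F)) :=
    (hsum.hasSum.mapL (ContinuousLinearMap.apply ℂ (CircLp p) F)).mapL (fc n)
  refine h1.unique ?_
  simp only [fc_substTerm]
  exact hasSum_fc_mulOp_expCoef mσ hσ mψ hψ F n (fc n f)

end Subst

end Circle

/-! ### The transformation kernel -/

/-- The cut-off at the point `x` of the parameter interval. -/
def cutoff (x : ℝ) (s : UnitAddCircle) : ℂ := if pos s < x then 1 else 0

theorem measurableSet_pos_lt (x : ℝ) : MeasurableSet {s | pos s < x} :=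
  measurable_pos measurableSet_Iio

theorem norm_cutoff_le (x : ℝ) (s : UnitAddCircle) : ‖cutoff x s‖ ≤ 1 := by
  unfold cutoff
  split_ifs <;> simp

theorem bddMeas_cutoff (x : ℝ) : BddMeas (cutoff x) :=
  ⟨Measurable.ite (measurableSet_pos_lt x) measurable_const measurable_const, 1, norm_cutoff_le x⟩

/-- The function `exp (-2 i lam s)` on the circle, read on `(0,1]`. -/
def expPos (lam : ℝ) (s : UnitAddCircle) : ℂ := Complex.exp (-2 * Complex.I * lam * pos s)

theorem norm_expPos (lam : ℝ) (s : UnitAddCircle) : ‖expPos lam s‖ = 1 := by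
  rw [expPos, show -2 * Complex.I * lam * pos s = ((-2 * lam * pos s : ℝ) : ℂ) * Complex.I by
    push_cast; ring]
  exact Complex.norm_exp_ofReal_mul_I _

theorem bddMeas_expPos (lam : ℝ) : BddMeas (expPos lam) := by
  refine ⟨?_, 1, fun s ↦ (norm_expPos lam s).le⟩
  exact Complex.measurable_exp.comp
    ((Complex.measurable_ofReal.comp measurable_pos).const_mul _)

theorem pos_sub {t : ℝ} (ht : t ≤ 1) {s : UnitAddCircle} (hs : pos s < t) :
    pos ((t : UnitAddCircle) - s) = t - pos s := by
  have h := pos_mem s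
  rw [← pos_coe (x := t - pos s) ⟨by linarith, by linarith [h.1]⟩, AddCircle.coe_sub, _root_.coe_pos]

theorem BddMeas.conj_sub {φ : UnitAddCircle → ℂ} (hφ : BddMeas φ) (t : UnitAddCircle) :
    BddMeas fun s ↦ starRingEnd ℂ (φ (t - s)) := by
  obtain ⟨C, hC⟩ := hφ.2
  exact ⟨(RCLike.continuous_conj (K := ℂ)).measurable.comp
    (hφ.1.comp (measurable_const.sub measurable_id)), C, fun s ↦ by simpa using hC _⟩

section Kernel

variable {p : ℝ≥0∞} [Fact (1 ≤ p)] [Fact (p ≠ ∞)]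

/-- Two cut-offs differ only over an interval of length `|x - y|`, and the `L_p` norm of `Q` over
sets of small measure is small. -/
theorem continuous_mulOp_cutoff (Q : CircLp p) :
    Continuous fun x ↦ mulOp _ (bddMeas_cutoff x) Q := by
  rw [Metric.continuous_iff]
  intro x ε hε
  obtain ⟨δ, hδ, h⟩ := (Lp.memLp Q).eLpNorm_indicator_le Fact.out Fact.out (half_pos hε)
  refine ⟨δ, hδ, fun y hy ↦ ?_⟩
  set s : Set UnitAddCircle := pos ⁻¹' Ico (min x y) (max x y) with hs
  have hms : MeasurableSet s := measurable_pos measurableSet_Ico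
  have hμ : circMeas s ≤ ENNReal.ofReal δ := by
    rw [hs, measurePreserving_pos.measure_preimage measurableSet_Ico.nullMeasurableSet]
    refine (Measure.restrict_apply_le _ _).trans ?_
    rw [Real.volume_Ico, max_sub_min_eq_abs]
    exact ENNReal.ofReal_le_ofReal hy.le
  refine lt_of_le_of_lt ?_ (half_lt_self hε)
  rw [dist_eq_norm, Lp.norm_def]
  refine ENNReal.toReal_le_of_le_ofReal (half_pos hε).le (le_trans ?_ (h s hms hμ))
  refine eLpNorm_mono_ae ?_
  filter_upwards [Lp.coeFn_sub (mulOp _ (bddMeas_cutoff y) Q) (mulOp _ (bddMeas_cutoff x) Q),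
    mulOp_ae (bddMeas_cutoff y) Q, mulOp_ae (bddMeas_cutoff x) Q] with u h1 h2 h3
  rw [h1, Pi.sub_apply, h2, h3]
  unfold cutoff
  by_cases hu : u ∈ s
  · rw [indicator_of_mem hu]
    split_ifs <;> simp
  · rw [indicator_of_notMem hu]
    have hu' : ¬ (min x y ≤ pos u ∧ pos u < max x y) := hu
    have : pos u < y ↔ pos u < x := by
      rcases le_total x y with hxy | hxy
      · rw [min_eq_left hxy, max_eq_right hxy] at hu'
        exact ⟨fun h ↦ lt_of_not_ge fun h' ↦ hu' ⟨h', h⟩, fun h ↦ h.trans_le hxy⟩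
      · rw [min_eq_right hxy, max_eq_left hxy] at hu'
        exact ⟨fun h ↦ h.trans_le hxy, fun h ↦ lt_of_not_ge fun h' ↦ hu' ⟨h', h⟩⟩
    simp [this]

/-- The operator `f ↦ conj f(t - ·)`. -/
def flipLp (t : ℝ) (f : CircLp p) : CircLp p := shiftLp (t : UnitAddCircle) (reflConj f)

omit [Fact (p ≠ ∞)] in
theorem norm_flipLp_le (t : ℝ) (f : CircLp p) : ‖flipLp t f‖ ≤ ‖f‖ :=
  (norm_shiftLp _ _).le.trans (norm_reflConj_le f)

theorem continuousOn_flipLp {f : ℝ → CircLp p} {s : Set ℝ} (hf : ContinuousOn f s) :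
    ContinuousOn (fun t ↦ flipLp t (f t)) s := by
  have h1 : Continuous fun t : ℝ ↦ (t : UnitAddCircle) := AddCircle.continuous_mk' 1
  have h2 : ContinuousOn (fun t ↦ reflConj (f t)) s := reflConj.continuous.comp_continuousOn hf
  have h3 : ContinuousOn (fun t : ℝ ↦ ((t : UnitAddCircle), reflConj (f t))) s :=
    h1.continuousOn.prodMk h2
  have h4 := (continuous_shiftLp (p := p)).comp_continuousOn h3
  simp only [Function.comp_def] at h4
  simpa only [flipLp] using h4

/-- The terms of the series for the transformation kernel. -/
def kernelTerm (q : ℝ → ℂ) (Q : CircLp p) : ℕ → ℝ → CircLp p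
  | 0 => fun x ↦ mulOp _ (bddMeas_cutoff x) Q
  | k + 1 => fun x ↦ ∫ t in (0 : ℝ)..x, q t • flipLp t (kernelTerm q Q k t)

variable {q : ℝ → ℂ} (hq : IntervalIntegrable q volume 0 1) (Q : CircLp p)

include hq

theorem continuousOn_kernelTerm (k : ℕ) : ContinuousOn (kernelTerm q Q k) (Icc 0 1) := by
  induction k with
  | zero => exact (continuous_mulOp_cutoff Q).continuousOn
  | succ k ih =>
    have h : IntervalIntegrable (fun t ↦ q t • flipLp t (kernelTerm q Q k t)) volume 0 1 :=
      hq.smul_continuousOn (by simpa using continuousOn_flipLp ih)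
    have hP : HasPrim (kernelTerm q Q (k + 1)) (fun t ↦ q t • flipLp t (kernelTerm q Q k t)) :=
      ⟨h, fun x _ ↦ by simp [kernelTerm]⟩
    exact hP.continuousOn

theorem intervalIntegrable_smul_flipLp (k : ℕ) :
    IntervalIntegrable (fun t ↦ q t • flipLp t (kernelTerm q Q k t)) volume 0 1 :=
  hq.smul_continuousOn (by simpa using continuousOn_flipLp (continuousOn_kernelTerm hq Q k))

omit [Fact (1 ≤ p)] [Fact (p ≠ ∞)] in
-- The inductive step of the factorial bound on `kernelTerm`, which makes the kernel series converge
-- for every integrable `q`.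
theorem hasPrim_pow_norm (k : ℕ) :
    HasPrim (fun x ↦ (∫ t in (0 : ℝ)..x, ‖q t‖) ^ (k + 1) / (k + 1).factorial)
      (fun x ↦ ‖q x‖ * ((∫ t in (0 : ℝ)..x, ‖q t‖) ^ k / k.factorial)) := by
  have hm : HasPrim (fun x ↦ ∫ t in (0 : ℝ)..x, ‖q t‖) (fun x ↦ ‖q x‖) :=
    ⟨hq.norm, fun x _ ↦ by simp⟩
  have hpow : ∀ k : ℕ, HasPrim (fun x ↦ (∫ t in (0 : ℝ)..x, ‖q t‖) ^ (k + 1))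
      (fun x ↦ (k + 1) * ‖q x‖ * (∫ t in (0 : ℝ)..x, ‖q t‖) ^ k) := by
    intro k
    induction k with
    | zero => simpa using hm
    | succ k ih =>
      refine (ih.mul hm).congr (fun x _ ↦ pow_succ _ _) (ae_of_all _ fun x _ ↦ ?_)
      push_cast
      ring
  refine ((hpow k).mul (HasPrim.const (((k + 1).factorial : ℝ)⁻¹))).congr
    (fun x _ ↦ div_eq_mul_inv _ _) (ae_of_all _ fun x _ ↦ ?_)
  rw [Nat.factorial_succ]
  push_cast
  field_simp
  ring

omit [Fact (p ≠ ∞)] in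
theorem norm_kernelTerm_le (k : ℕ) {x : ℝ} (hx : x ∈ Icc (0 : ℝ) 1) :
    ‖kernelTerm q Q k x‖ ≤ ‖Q‖ * ((∫ t in (0 : ℝ)..x, ‖q t‖) ^ k / k.factorial) := by
  induction k generalizing x with
  | zero => simpa [kernelTerm] using norm_mulOp_le (bddMeas_cutoff x) (norm_cutoff_le x) Q
  | succ k ih =>
    have hP := (HasPrim.const ‖Q‖).mul (hasPrim_pow_norm hq k)
    have h := hP.2 x hx
    simp only [intervalIntegral.integral_same, ne_eq, Nat.succ_ne_zero, not_false_eq_true,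
      zero_pow, zero_div, mul_zero, zero_add, zero_mul] at h
    rw [h, kernelTerm]
    have hP1 := intervalIntegrable_sub_of_mem hP.1 (x := 0) (by simp) hx
    simp only [zero_mul, zero_add] at hP1
    refine intervalIntegral.norm_integral_le_of_norm_le hx.1 (ae_of_all _ fun t ht ↦ ?_) hP1
    rw [norm_smul]
    calc _ ≤ ‖q t‖ * (‖Q‖ * ((∫ t in (0 : ℝ)..t, ‖q t‖) ^ k / k.factorial)) := by
          gcongr
          exact (norm_flipLp_le _ _).trans (ih ⟨ht.1.le, ht.2.trans hx.2⟩)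
      _ = _ := by ring

omit [Fact (p ≠ ∞)] in
theorem norm_kernelTerm_le' (k : ℕ) {x : ℝ} (hx : x ∈ Icc (0 : ℝ) 1) :
    ‖kernelTerm q Q k x‖ ≤ ‖Q‖ * ((∫ t in (0 : ℝ)..1, ‖q t‖) ^ k / k.factorial) := by
  refine (norm_kernelTerm_le hq Q k hx).trans ?_
  have h0 : 0 ≤ ∫ t in (0 : ℝ)..x, ‖q t‖ :=
    intervalIntegral.integral_nonneg hx.1 fun _ _ ↦ norm_nonneg _
  have h1 : ∫ t in (0 : ℝ)..x, ‖q t‖ ≤ ∫ t in (0 : ℝ)..1, ‖q t‖ :=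
    intervalIntegral.integral_mono_interval le_rfl hx.1 hx.2 (ae_of_all _ fun _ ↦ norm_nonneg _)
      hq.norm
  gcongr

theorem pairing_kernelTerm_succ {φ : UnitAddCircle → ℂ} (hφ : BddMeas φ) (k : ℕ) {x : ℝ}
    (hx : x ∈ Icc (0 : ℝ) 1) :
    pairing φ hφ (kernelTerm q Q (k + 1) x)
      = ∫ t in (0 : ℝ)..x, q t * pairing φ hφ (flipLp t (kernelTerm q Q k t)) := by
  rw [kernelTerm, ← (pairing φ hφ).intervalIntegral_comp_comm
    (intervalIntegrable_sub_of_mem (intervalIntegrable_smul_flipLp hq Q k) (by simp) hx)]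
  simp

/-- The kernel at `x` is supported in parameters below `x`, expressed by duality. For `pos s < t`
the reflected point `t - s` has position in `(0,t)`, so there is no wrap-around and the support
property passes to the next term. -/
theorem pairing_kernelTerm_eq_zero {φ : UnitAddCircle → ℂ} (hφ : BddMeas φ) (k : ℕ) {x : ℝ}
    (hx : x ∈ Icc (0 : ℝ) 1) (h : ∀ s, pos s < x → φ s = 0) :
    pairing φ hφ (kernelTerm q Q k x) = 0 := by
  induction k generalizing x φ with
  | zero =>
    rw [pairing_apply]
    refine integral_eq_zero_of_ae ?_
    filter_upwards [mulOp_ae (bddMeas_cutoff x) Q] with s hs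
    simp only [kernelTerm, hs, cutoff, Pi.zero_apply]
    split_ifs with h1
    · rw [h s h1, zero_mul]
    · simp
  | succ k ih =>
    rw [pairing_kernelTerm_succ hq Q hφ k hx]
    refine intervalIntegral.integral_zero_ae (ae_of_all _ fun t ht ↦ ?_)
    rw [uIoc_of_le hx.1] at ht
    rw [flipLp, pairing_shiftLp_reflConj hφ (hφ.conj_sub t) _ (fun _ ↦ rfl),
      ih (hφ.conj_sub t) ⟨ht.1.le, ht.2.trans hx.2⟩, map_zero, mul_zero]
    intro s hs
    rw [h _ ?_, map_zero]
    rw [pos_sub (ht.2.trans hx.2) hs]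
    linarith [(pos_mem s).1, ht.2]

/-- On the support of the kernel at `t` the reflected exponential is the original one times a
constant; off the support the two test functions may differ without effect. -/
theorem pairing_expPos_flipLp_kernelTerm (lam : ℝ) (k : ℕ) {t : ℝ} (ht : t ∈ Icc (0 : ℝ) 1) :
    pairing _ (bddMeas_expPos lam) (flipLp t (kernelTerm q Q k t))
      = Complex.exp (-2 * Complex.I * lam * t)
        * starRingEnd ℂ (pairing _ (bddMeas_expPos lam) (kernelTerm q Q k t)) := by
  set c := Complex.exp (-2 * Complex.I * lam * t) with hc
  have hb := (bddMeas_expPos lam).conj_sub (t : UnitAddCircle)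
  have hb2 : BddMeas fun s ↦ starRingEnd ℂ (expPos lam (t - s)) - starRingEnd ℂ c * expPos lam s :=
    ⟨hb.1.sub ((bddMeas_expPos lam).1.const_mul _), 1 + ‖c‖, fun s ↦ by
      refine (norm_sub_le _ _).trans ?_
      simp [norm_expPos]⟩
  have h0 : pairing _ hb2 (kernelTerm q Q k t) = 0 := by
    refine pairing_kernelTerm_eq_zero hq Q hb2 k ht fun s hs ↦ ?_
    rw [expPos, expPos, pos_sub ht.2 hs, hc, ← Complex.exp_conj, ← Complex.exp_conj,
      ← Complex.exp_add, sub_eq_zero]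
    congr 1
    have h2 : starRingEnd ℂ 2 = 2 := map_ofNat _ 2
    simp [h2]
    ring
  have h1 : pairing _ hb2 (kernelTerm q Q k t) = pairing _ hb (kernelTerm q Q k t)
      - starRingEnd ℂ c * pairing _ (bddMeas_expPos lam) (kernelTerm q Q k t) := by
    have hi : ∀ {φ : UnitAddCircle → ℂ} (hφ : BddMeas φ),
        Integrable (fun s ↦ φ s * kernelTerm q Q k t s) circMeas := fun hφ ↦
      (hφ.memLp_mul _).integrable Fact.out
    rw [pairing_apply, pairing_apply, pairing_apply, ← integral_const_mul,
      ← integral_sub (hi hb) ((hi (bddMeas_expPos lam)).const_mul _)]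
    exact integral_congr_ae (ae_of_all _ fun s ↦ by ring)
  rw [flipLp, pairing_shiftLp_reflConj (bddMeas_expPos lam) hb _ (fun _ ↦ rfl)]
  rw [h1, sub_eq_zero] at h0
  rw [h0, map_mul, Complex.conj_conj]

/-- The transformation kernel. -/
def kernel (q : ℝ → ℂ) (Q : CircLp p) (x : ℝ) : CircLp p := ∑' k, kernelTerm q Q k x

omit hq [Fact (1 ≤ p)] [Fact (p ≠ ∞)] in
theorem summable_kernelBound (q : ℝ → ℂ) (Q : CircLp p) :
    Summable fun k : ℕ ↦ ‖Q‖ * ((∫ t in (0 : ℝ)..1, ‖q t‖) ^ k / k.factorial) :=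
  (Real.summable_pow_div_factorial _).mul_left _

theorem continuousOn_kernel : ContinuousOn (kernel q Q) (Icc 0 1) :=
  continuousOn_tsum (continuousOn_kernelTerm hq Q) (summable_kernelBound q Q)
    fun k _ hx ↦ norm_kernelTerm_le' hq Q k hx

omit [Fact (p ≠ ∞)] in
theorem hasSum_kernel {x : ℝ} (hx : x ∈ Icc (0 : ℝ) 1) :
    HasSum (fun k ↦ kernelTerm q Q k x) (kernel q Q x) :=
  (Summable.of_norm_bounded (summable_kernelBound q Q)
    fun k ↦ norm_kernelTerm_le' hq Q k hx).hasSum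

omit hq [Fact (p ≠ ∞)] in
theorem pairing_kernelTerm_zero (hQ : Q =ᵐ[circMeas] fun s ↦ q (pos s)) (lam : ℝ) {x : ℝ}
    (hx : x ∈ Icc (0 : ℝ) 1) :
    pairing _ (bddMeas_expPos lam) (kernelTerm q Q 0 x)
      = ∫ t in (0 : ℝ)..x, q t * Complex.exp (-2 * Complex.I * lam * t) := by
  have h1 : pairing _ (bddMeas_expPos lam) (kernelTerm q Q 0 x)
      = ∫ s, expPos lam s * (cutoff x s * q (pos s)) ∂circMeas := by
    rw [pairing_apply]
    refine integral_congr_ae ?_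
    filter_upwards [mulOp_ae (bddMeas_cutoff x) Q, hQ] with s h1 h2
    rw [kernelTerm, h1, h2]
  rw [h1, integral_circMeas, intervalIntegral.integral_of_le zero_le_one,
    intervalIntegral.integral_of_le hx.1, integral_Ioc_eq_integral_Ioo (y := x),
    setIntegral_eq_of_subset_of_forall_sdiff_eq_zero (s := Ioo 0 x) measurableSet_Ioc
      (fun t ht ↦ ⟨ht.1, ht.2.le.trans hx.2⟩)]
  · refine setIntegral_congr_fun measurableSet_Ioo fun t ht ↦ ?_
    have hpt := pos_coe ⟨ht.1, ht.2.le.trans hx.2⟩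
    simp only [expPos, cutoff, hpt, if_pos ht.2]
    ring
  · intro t ht
    have hpt := pos_coe ht.1
    have htx : ¬ t < x := fun h ↦ ht.2 ⟨ht.1.1, h⟩
    simp only [cutoff, hpt, if_neg htx]
    ring

/-- The amplitude `a(x) = 1 + ∫ A(x,s) exp (-2 i lam s) ds` attached to the kernel `A`. -/
def amplitude (q : ℝ → ℂ) (Q : CircLp p) (lam : ℝ) (x : ℝ) : ℂ :=
  1 + pairing _ (bddMeas_expPos lam) (kernel q Q x)

theorem continuousOn_amplitude (lam : ℝ) : ContinuousOn (amplitude q Q lam) (Icc 0 1) :=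
  continuousOn_const.add
    ((pairing _ (bddMeas_expPos lam)).continuous.comp_continuousOn (continuousOn_kernel hq Q))

/-- The recursion of `kernelTerm` is the Picard iteration of this equation; it is summed under the
integral by dominated convergence. -/
theorem amplitude_eq (hQ : Q =ᵐ[circMeas] fun s ↦ q (pos s)) (lam : ℝ) {x : ℝ}
    (hx : x ∈ Icc (0 : ℝ) 1) :
    amplitude q Q lam x = 1 + ∫ t in (0 : ℝ)..x,
      q t * (Complex.exp (-2 * Complex.I * lam * t) * starRingEnd ℂ (amplitude q Q lam t)) := by
  have h01 : (0 : ℝ) ∈ Icc (0 : ℝ) 1 := by simp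
  set e : ℝ → ℂ := fun t ↦ Complex.exp (-2 * Complex.I * lam * t) with he
  have hec : Continuous e := by fun_prop
  have hen : ∀ t, ‖e t‖ = 1 := fun t ↦ by
    simp only [he]
    rw [show -2 * Complex.I * lam * t = ((-2 * lam * t : ℝ) : ℂ) * Complex.I by
      push_cast; ring]
    exact Complex.norm_exp_ofReal_mul_I _
  set P := pairing (p := p) _ (bddMeas_expPos lam) with hP
  have hPn : ∀ f, ‖P f‖ ≤ ‖f‖ := fun f ↦ by
    simpa using norm_pairing_le (bddMeas_expPos lam) (C := 1) (fun s ↦ (norm_expPos lam s).le) f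
  have hsum : ∀ y ∈ Icc (0 : ℝ) 1, HasSum (fun k ↦ P (kernelTerm q Q k y)) (P (kernel q Q y)) :=
    fun y hy ↦ (hasSum_kernel hq Q hy).mapL P
  have hqx := intervalIntegrable_sub_of_mem hq h01 hx
  have hsub : uIcc 0 x ⊆ Icc (0 : ℝ) 1 := uIcc_subset_Icc h01 hx
  have hterm : ∀ k, P (kernelTerm q Q (k + 1) x)
      = ∫ t in (0 : ℝ)..x, q t * (e t * starRingEnd ℂ (P (kernelTerm q Q k t))) := by
    intro k
    rw [hP, pairing_kernelTerm_succ hq Q _ k hx]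
    refine intervalIntegral.integral_congr fun t ht ↦ ?_
    rw [pairing_expPos_flipLp_kernelTerm hq Q lam k (hsub ht)]
  have hint : ∀ k, IntervalIntegrable
      (fun t ↦ q t * (e t * starRingEnd ℂ (P (kernelTerm q Q k t)))) volume 0 x := fun k ↦
    hqx.mul_continuousOn (hec.continuousOn.mul (RCLike.continuous_conj.comp_continuousOn
      (P.continuous.comp_continuousOn ((continuousOn_kernelTerm hq Q k).mono hsub))))
  have hS : HasSum (fun k ↦ P (kernelTerm q Q (k + 1) x))
      (∫ t in (0 : ℝ)..x, q t * (e t * starRingEnd ℂ (P (kernel q Q t)))) := by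
    simp only [hterm]
    refine intervalIntegral.hasSum_integral_of_dominated_convergence
      (fun k t ↦ ‖q t‖ * (‖Q‖ * ((∫ t in (0 : ℝ)..1, ‖q t‖) ^ k / k.factorial)))
      (fun k ↦ ((intervalIntegrable_iff.1 (hint k))).aestronglyMeasurable)
      (fun k ↦ ae_of_all _ fun t ht ↦ ?_) (ae_of_all _ fun t _ ↦ ?_) ?_
      (ae_of_all _ fun t ht ↦ ?_)
    · rw [norm_mul, norm_mul, hen, one_mul, RCLike.norm_conj]
      gcongr
      exact (hPn _).trans (norm_kernelTerm_le' hq Q k (hsub (uIoc_subset_uIcc ht)))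
    · exact (summable_kernelBound q Q).mul_left _
    · simp only [tsum_mul_left]
      exact hqx.norm.mul_const _
    · have := hsum t (hsub (uIoc_subset_uIcc ht))
      exact ((Complex.hasSum_conj'.2 (by simpa using this)).mul_left _).mul_left _
  have h1 := (hasSum_nat_add_iff' 1).2 (hsum x hx)
  have h2 := h1.unique hS
  rw [Finset.sum_range_one, hP, pairing_kernelTerm_zero Q hQ lam hx, ← hP] at h2
  have hq1 : IntervalIntegrable (fun t ↦ q t * e t) volume 0 x :=
    hqx.mul_continuousOn hec.continuousOn
  have hq2 : IntervalIntegrable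
      (fun t ↦ q t * (e t * starRingEnd ℂ (P (kernel q Q t)))) volume 0 x :=
    hqx.mul_continuousOn (hec.continuousOn.mul (RCLike.continuous_conj.comp_continuousOn
      (P.continuous.comp_continuousOn ((continuousOn_kernel hq Q).mono hsub))))
  rw [amplitude, ← hP, sub_eq_iff_eq_add.1 h2, ← intervalIntegral.integral_add hq2 hq1]
  congr 1
  refine intervalIntegral.integral_congr fun t _ ↦ ?_
  simp only [amplitude, map_add, map_one]
  ring

end Kernel

/-! ### The Dirac system as a system of integral equations -/

theorem diracExpr_eq_smul_iff (q₁ q₂ : ℝ → ℝ) (u : ℝ → Fin 2 → ℂ) (lam : ℂ) (x : ℝ) :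
    diracExpr q₁ q₂ u x = lam • u x ↔
      deriv (fun t ↦ u t 0) x = q₂ x * u x 0 - q₁ x * u x 1 - lam * u x 1 ∧
      deriv (fun t ↦ u t 1) x = lam * u x 0 - q₁ x * u x 0 - q₂ x * u x 1 := by
  rw [funext_iff, Fin.forall_fin_two]
  simp only [diracExpr, diracB, diracQ, Matrix.mulVec, dotProduct, Fin.sum_univ_two, Pi.add_apply,
    Pi.smul_apply, smul_eq_mul, Matrix.of_apply, Matrix.cons_val_zero, Matrix.cons_val_one]
  constructor
  · rintro ⟨h1, h2⟩
    exact ⟨by linear_combination -h2, by linear_combination h1⟩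
  · rintro ⟨h1, h2⟩
    rw [h1, h2]
    constructor <;> ring

theorem ae_volUnit_iff {P : ℝ → Prop} :
    (∀ᵐ x ∂volUnit, P x) ↔ ∀ᵐ x, x ∈ Icc (0 : ℝ) 1 → P x := by
  rw [volUnit, ae_restrict_iff' measurableSet_Ioo]
  refine ⟨ae_mem_Ioo_of_ae_mem_Icc, fun h ↦ ?_⟩
  filter_upwards [h] with x hx hx' using hx (Ioo_subset_Icc_self hx')

/-- Dirac solutions, expressed by integral equations. -/
def IsIntSolution (q₁ q₂ : ℝ → ℝ) (lam : ℂ) (u : ℝ → Fin 2 → ℂ) : Prop :=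
  HasPrim (fun t ↦ u t 0) (fun x ↦ q₂ x * u x 0 - q₁ x * u x 1 - lam * u x 1) ∧
  HasPrim (fun t ↦ u t 1) (fun x ↦ lam * u x 0 - q₁ x * u x 0 - q₂ x * u x 1)

theorem isDiracSolution_iff {q₁ q₂ : ℝ → ℝ} {lam : ℂ} {u : ℝ → Fin 2 → ℂ} :
    IsDiracSolution q₁ q₂ lam u ↔ IsIntSolution q₁ q₂ lam u := by
  simp only [IsDiracSolution, IsAC, ae_volUnit_iff, diracExpr_eq_smul_iff]
  constructor
  · rintro ⟨hac, h⟩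
    refine ⟨(HasPrim.of_absolutelyContinuous (hac 0)).1.congr (fun _ _ ↦ rfl) ?_,
      (HasPrim.of_absolutelyContinuous (hac 1)).1.congr (fun _ _ ↦ rfl) ?_⟩
    · filter_upwards [h] with x hx hx' using (hx hx').1.symm
    · filter_upwards [h] with x hx hx' using (hx hx').2.symm
  · rintro ⟨h0, h1⟩
    refine ⟨fun i ↦ ?_, ?_⟩
    · fin_cases i
      · exact h0.absolutelyContinuous
      · exact h1.absolutelyContinuous
    · filter_upwards [h0.ae_hasDerivAt, h1.ae_hasDerivAt] with x hx0 hx1 hx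
      exact ⟨(hx0 hx).deriv, (hx1 hx).deriv⟩

theorem HasPrim.neg' {f f' : ℝ → ℂ} (hf : HasPrim f f') :
    HasPrim (fun x ↦ -f x) (fun x ↦ -f' x) := by
  simpa using hf.clm (-ContinuousLinearMap.id ℝ ℂ)

theorem IsIntSolution.wronskian {q₁ q₂ : ℝ → ℝ} {lam : ℂ} {u v : ℝ → Fin 2 → ℂ}
    (hu : IsIntSolution q₁ q₂ lam u) (hv : IsIntSolution q₁ q₂ lam v) {x : ℝ}
    (hx : x ∈ Icc (0 : ℝ) 1) : u x 0 * v x 1 - u x 1 * v x 0 = u 0 0 * v 0 1 - u 0 1 * v 0 0 := by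
  have h := (hu.1.mul hv.2).add (hu.2.mul hv.1).neg'
  have h0 := h.eq_of_ae_zero (ae_of_all _ fun t _ ↦ by ring) hx
  simpa [sub_eq_add_neg] using h0

/-- Uniqueness by Cramer's rule: the three constant Wronskians of `u`, `c`, `s` determine `u`. -/
theorem IsIntSolution.eq_smul {q₁ q₂ : ℝ → ℝ} {lam : ℂ} {c s u : ℝ → Fin 2 → ℂ}
    (hc : IsIntSolution q₁ q₂ lam c) (hs : IsIntSolution q₁ q₂ lam s)
    (hu : IsIntSolution q₁ q₂ lam u) (hc0 : c 0 0 = 1) (hc1 : c 0 1 = 0) (hs0 : s 0 0 = 0)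
    (hs1 : s 0 1 = 1) (hu1 : u 0 1 = 0) {x : ℝ} (hx : x ∈ Icc (0 : ℝ) 1) :
    u x 0 = u 0 0 * c x 0 ∧ u x 1 = u 0 0 * c x 1 := by
  have h1 := hu.wronskian hc hx
  have h2 := hu.wronskian hs hx
  have h3 := hc.wronskian hs hx
  simp only [hc0, hc1, hs0, hs1, hu1, mul_zero, mul_one, sub_zero] at h1 h2 h3
  constructor
  · linear_combination (-u x 0) * h3 + c x 0 * h2 - s x 0 * h1
  · linear_combination (-u x 1) * h3 + c x 1 * h2 - s x 1 * h1

/-- A nonzero solution satisfying the boundary conditions has a real spectral parameter. -/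
theorem IsIntSolution.im_eq_zero {q₁ q₂ : ℝ → ℝ} {lam : ℂ} {u : ℝ → Fin 2 → ℂ}
    (hu : IsIntSolution q₁ q₂ lam u) (h0 : u 0 1 = 0) (h1 : u 1 0 = 0)
    (hne : ¬ ∀ᵐ x, x ∈ Icc (0 : ℝ) 1 → u x = 0) : lam.im = 0 := by
  by_contra him
  -- The imaginary part of `u₁ conj u₂` vanishes at both ends by the boundary conditions, while its
  -- derivative is `-Im lam` times `|u₁|² + |u₂|²`.
  have hP := (hu.1.mul (hu.2.clm Complex.conjCLE.toContinuousLinearMap)).clm Complex.imCLM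
  have hQ : HasPrim (fun x ↦ (u x 0 * starRingEnd ℂ (u x 1)).im)
      (fun x ↦ -lam.im * (‖u x 0‖ ^ 2 + ‖u x 1‖ ^ 2)) := by
    refine hP.congr (fun x _ ↦ rfl) (ae_of_all _ fun x _ ↦ ?_)
    simp [← Complex.normSq_eq_norm_sq, Complex.normSq_apply]
    ring
  have hI := hQ.2 1 (by simp)
  simp only [h0, h1, zero_mul, map_zero, mul_zero, Complex.zero_im, zero_add] at hI
  rw [intervalIntegral.integral_const_mul, eq_comm, mul_eq_zero, neg_eq_zero] at hI
  have hi : IntervalIntegrable (fun x ↦ ‖u x 0‖ ^ 2 + ‖u x 1‖ ^ 2) volume 0 1 := by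
    apply ContinuousOn.intervalIntegrable
    rw [uIcc_of_le zero_le_one]
    exact (hu.1.continuousOn.norm.pow 2).add (hu.2.continuousOn.norm.pow 2)
  have hz := (intervalIntegral.integral_eq_zero_iff_of_le_of_nonneg_ae zero_le_one
    (ae_of_all _ fun x ↦ by positivity) hi).1 (hI.resolve_left him)
  apply hne
  apply ae_mem_Ioo_of_ae_mem_Icc
  filter_upwards [(ae_restrict_iff' measurableSet_Ioc).1 hz] with x hx hx'
  have h := hx (Ioo_subset_Ioc_self hx')
  simp only [Pi.zero_apply] at h
  have e0 : ‖u x 0‖ ^ 2 = 0 := by nlinarith [sq_nonneg ‖u x 0‖, sq_nonneg ‖u x 1‖]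
  have e1 : ‖u x 1‖ ^ 2 = 0 := by nlinarith [sq_nonneg ‖u x 0‖, sq_nonneg ‖u x 1‖]
  funext i
  fin_cases i
  · simpa using e0
  · simpa using e1

/-! ### The complex form of the system for a real spectral parameter -/

/-- The complex form `z' = i lam z + q conj z` of the Dirac system. -/
def IsComplexSolution (q : ℝ → ℂ) (lam : ℝ) (z : ℝ → ℂ) : Prop :=
  HasPrim z fun x ↦ Complex.I * lam * z x + q x * starRingEnd ℂ (z x)

/-- The complex potential `q₂ - i q₁`. -/
def complexPot (q₁ q₂ : ℝ → ℝ) (x : ℝ) : ℂ := q₂ x - Complex.I * q₁ x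

/-- The vector with components the real and imaginary part of `z`. -/
def reImVec (z : ℝ → ℂ) (x : ℝ) : Fin 2 → ℂ := ![((z x).re : ℂ), ((z x).im : ℂ)]

theorem IsComplexSolution.isIntSolution {q₁ q₂ : ℝ → ℝ} {lam : ℝ} {z : ℝ → ℂ}
    (h : IsComplexSolution (complexPot q₁ q₂) lam z) :
    IsIntSolution q₁ q₂ lam (reImVec z) := by
  constructor
  · refine ((h.clm Complex.reCLM).clm Complex.ofRealCLM).congr (fun x _ ↦ rfl)
      (ae_of_all _ fun x _ ↦ ?_)
    simp only [reImVec, Matrix.cons_val_zero, Matrix.cons_val_one, Complex.reCLM_apply,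
      Complex.ofRealCLM_apply]
    norm_cast
    simp [complexPot]
    ring
  · refine ((h.clm Complex.imCLM).clm Complex.ofRealCLM).congr (fun x _ ↦ rfl)
      (ae_of_all _ fun x _ ↦ ?_)
    simp only [reImVec, Matrix.cons_val_zero, Matrix.cons_val_one, Complex.imCLM_apply,
      Complex.ofRealCLM_apply]
    norm_cast
    simp [complexPot]
    ring

theorem IsComplexSolution.wronskian {q : ℝ → ℂ} {lam : ℝ} {z w : ℝ → ℂ}
    (hz : IsComplexSolution q lam z) (hw : IsComplexSolution q lam w) {x : ℝ}
    (hx : x ∈ Icc (0 : ℝ) 1) :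
    (starRingEnd ℂ (z x) * w x).im = (starRingEnd ℂ (z 0) * w 0).im := by
  have hP := ((hz.clm Complex.conjCLE.toContinuousLinearMap).mul hw).clm Complex.imCLM
  refine hP.eq_of_ae_zero (ae_of_all _ fun t _ ↦ ?_) hx
  simp
  ring

/-- Since `conj i = -i`, multiplication by `i` flips the sign of the potential. The solution
starting at `i` thus comes from the same construction applied to `-q`. -/
theorem IsComplexSolution.I_mul {q : ℝ → ℂ} {lam : ℝ} {z : ℝ → ℂ}
    (hz : IsComplexSolution (fun x ↦ -q x) lam z) :
    IsComplexSolution q lam fun x ↦ Complex.I * z x := by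
  refine ((HasPrim.const Complex.I).mul hz).congr (fun _ _ ↦ rfl) (ae_of_all _ fun x _ ↦ ?_)
  simp only [map_mul, Complex.conj_I]
  ring

theorem hasPrim_const_mul_ofReal (c : ℂ) : HasPrim (fun x : ℝ ↦ c * x) (fun _ ↦ c) :=
  ⟨intervalIntegrable_const, fun x _ ↦ by simp [mul_comm]⟩

theorem hasPrim_const_mul_real (c : ℝ) : HasPrim (fun x : ℝ ↦ c * x) (fun _ ↦ c) :=
  ⟨intervalIntegrable_const, fun x _ ↦ by simp [mul_comm]⟩

section Solution

variable {p : ℝ≥0∞} [Fact (1 ≤ p)] [Fact (p ≠ ∞)]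

/-- The complex solution with initial value `1`. -/
def complexSol (q : ℝ → ℂ) (Q : CircLp p) (lam x : ℝ) : ℂ :=
  Complex.exp (Complex.I * lam * x) * amplitude q Q lam x

variable {q : ℝ → ℂ} (hq : IntervalIntegrable q volume 0 1) {Q : CircLp p}
  (hQ : Q =ᵐ[circMeas] fun s ↦ q (pos s))

include hq hQ

theorem amplitude_zero (lam : ℝ) : amplitude q Q lam 0 = 1 := by
  rw [amplitude_eq hq Q hQ lam (by simp)]
  simp

theorem hasPrim_amplitude (lam : ℝ) : HasPrim (amplitude q Q lam) fun t ↦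
    q t * (Complex.exp (-2 * Complex.I * lam * t) * starRingEnd ℂ (amplitude q Q lam t)) := by
  refine ⟨hq.mul_continuousOn ?_, fun x hx ↦ ?_⟩
  · have h1 : Continuous fun t : ℝ ↦ Complex.exp (-2 * Complex.I * lam * t) := by fun_prop
    rw [uIcc_of_le zero_le_one]
    exact h1.continuousOn.mul
      (RCLike.continuous_conj.comp_continuousOn (continuousOn_amplitude hq Q lam))
  · rw [amplitude_zero hq hQ, amplitude_eq hq Q hQ lam hx]

theorem isComplexSolution_complexSol (lam : ℝ) :
    IsComplexSolution q lam (complexSol q Q lam) := by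
  have h := (hasPrim_const_mul_ofReal (Complex.I * lam)).cexp.mul (hasPrim_amplitude hq hQ lam)
  refine h.congr (fun _ _ ↦ rfl) (ae_of_all _ fun x _ ↦ ?_)
  have e1 : starRingEnd ℂ (Complex.exp (Complex.I * lam * x))
      = Complex.exp (Complex.I * lam * x) * Complex.exp (-2 * Complex.I * lam * x) := by
    rw [← Complex.exp_conj, ← Complex.exp_add]
    congr 1
    simp
    ring
  simp only [complexSol, map_mul, e1]
  ring

theorem complexSol_zero (lam : ℝ) : complexSol q Q lam 0 = 1 := by
  simp [complexSol, amplitude_zero hq hQ]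

/-- The solution with initial value `i`. -/
theorem exists_second_solution (lam : ℝ) :
    ∃ w : ℝ → ℂ, IsComplexSolution q lam w ∧ w 0 = Complex.I := by
  have hQ' : (-Q : CircLp p) =ᵐ[circMeas] fun s ↦ (fun x ↦ -q x) (pos s) := by
    filter_upwards [hQ, Lp.coeFn_neg Q] with s h1 h2
    rw [h2, Pi.neg_apply, h1]
  refine ⟨_, (isComplexSolution_complexSol (q := fun x ↦ -q x) hq.neg hQ' lam).I_mul, ?_⟩
  rw [complexSol_zero (q := fun x ↦ -q x) hq.neg hQ', mul_one]

/-- The Wronskian with the solution starting at `i` is constantly `1`, which excludes zeros; this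
permits a global logarithm and hence the angle. -/
theorem complexSol_ne_zero (lam : ℝ) {x : ℝ} (hx : x ∈ Icc (0 : ℝ) 1) :
    complexSol q Q lam x ≠ 0 := by
  obtain ⟨w, hw, hw0⟩ := exists_second_solution hq hQ lam
  intro h
  have := (isComplexSolution_complexSol hq hQ lam).wronskian hw hx
  rw [h, complexSol_zero hq hQ, hw0] at this
  simp at this

/-! ### The Prüfer angle -/

omit hQ hq in
/-- The logarithm of the amplitude. -/
def logAmp (q : ℝ → ℂ) (Q : CircLp p) (lam x : ℝ) : ℂ :=
  ∫ t in (0 : ℝ)..x, q t * (starRingEnd ℂ (complexSol q Q lam t) / complexSol q Q lam t)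

theorem hasPrim_logAmp (lam : ℝ) : HasPrim (logAmp q Q lam)
    fun t ↦ q t * (starRingEnd ℂ (complexSol q Q lam t) / complexSol q Q lam t) := by
  have hc := (isComplexSolution_complexSol hq hQ lam).continuousOn
  refine ⟨hq.mul_continuousOn ?_, fun x _ ↦ by simp [logAmp]⟩
  rw [uIcc_of_le zero_le_one]
  exact (RCLike.continuous_conj.comp_continuousOn hc).div hc
    fun x hx ↦ complexSol_ne_zero hq hQ lam hx

omit hQ hq [Fact (p ≠ ∞)] in
theorem logAmp_zero (lam : ℝ) : logAmp q Q lam 0 = 0 := by simp [logAmp]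

theorem complexSol_eq_exp (lam : ℝ) {x : ℝ} (hx : x ∈ Icc (0 : ℝ) 1) :
    complexSol q Q lam x = Complex.exp (Complex.I * lam * x + logAmp q Q lam x) := by
  have h1 := ((hasPrim_const_mul_ofReal (Complex.I * lam)).add (hasPrim_logAmp hq hQ lam)).neg'
  have h2 := (isComplexSolution_complexSol hq hQ lam).mul h1.cexp
  have h3 := h2.eq_of_ae_zero (ae_of_all _ fun t ht ↦ ?_) hx
  · simp only [complexSol_zero hq hQ, logAmp_zero, Complex.ofReal_zero, mul_zero, add_zero,
      neg_zero, Complex.exp_zero, mul_one] at h3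
    rw [Complex.exp_neg] at h3
    exact (mul_inv_eq_one₀ (Complex.exp_ne_zero _)).1 h3
  · have := complexSol_ne_zero hq hQ lam ht
    field_simp
    ring

/-- The Prüfer angle of the solution. -/
def angle (q : ℝ → ℂ) (Q : CircLp p) (lam x : ℝ) : ℝ := lam * x + (logAmp q Q lam x).im

theorem complexSol_polar (lam : ℝ) {x : ℝ} (hx : x ∈ Icc (0 : ℝ) 1) :
    complexSol q Q lam x = Real.exp (logAmp q Q lam x).re
      * Complex.exp (angle q Q lam x * Complex.I) := by
  rw [complexSol_eq_exp hq hQ lam hx, Complex.ofReal_exp, ← Complex.exp_add]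
  congr 1
  apply Complex.ext <;> simp [angle]

theorem conj_div_complexSol (lam : ℝ) {x : ℝ} (hx : x ∈ Icc (0 : ℝ) 1) :
    starRingEnd ℂ (complexSol q Q lam x) / complexSol q Q lam x
      = Complex.exp (-2 * angle q Q lam x * Complex.I) := by
  rw [div_eq_iff (complexSol_ne_zero hq hQ lam hx), complexSol_polar hq hQ lam hx, map_mul,
    Complex.conj_ofReal, ← Complex.exp_conj, mul_left_comm, ← Complex.exp_add]
  congr 2
  simp
  ring

theorem hasPrim_angle (lam : ℝ) : HasPrim (angle q Q lam)
    fun t ↦ lam + (q t * Complex.exp (-2 * angle q Q lam t * Complex.I)).im := by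
  refine ((hasPrim_const_mul_real lam).add ((hasPrim_logAmp hq hQ lam).clm Complex.imCLM)).congr
    (fun _ _ ↦ rfl) (ae_of_all _ fun x hx ↦ ?_)
  rw [conj_div_complexSol hq hQ lam hx]
  rfl

omit hQ hq [Fact (p ≠ ∞)] in
theorem angle_zero (lam : ℝ) : angle q Q lam 0 = 0 := by simp [angle, logAmp_zero]

theorem abs_angle_sub_le (lam : ℝ) :
    |angle q Q lam 1 - lam| ≤ ∫ t in (0 : ℝ)..1, ‖q t‖ := by
  have h := hasPrim_logAmp hq hQ lam
  have e : angle q Q lam 1 - lam = (logAmp q Q lam 1).im := by simp [angle]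
  rw [e]
  refine (Complex.abs_im_le_norm _).trans ?_
  rw [logAmp]
  refine intervalIntegral.norm_integral_le_of_norm_le zero_le_one (ae_of_all _ fun t ht ↦ ?_)
    hq.norm
  rw [conj_div_complexSol hq hQ lam ⟨ht.1.le, ht.2⟩, norm_mul]
  refine mul_le_of_le_one_right (norm_nonneg _) ?_
  rw [show -2 * (angle q Q lam t : ℂ) * Complex.I = ((-2 * angle q Q lam t : ℝ) : ℂ) * Complex.I by
    push_cast; ring, Complex.norm_exp_ofReal_mul_I]

omit hQ hq [Fact (1 ≤ p)] [Fact (p ≠ ∞)] in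
theorem norm_exp_sub_exp_le (a b : ℝ) :
    ‖Complex.exp (-2 * a * Complex.I) - Complex.exp (-2 * b * Complex.I)‖ ≤ 2 * |a - b| := by
  have e : Complex.exp (-2 * a * Complex.I) - Complex.exp (-2 * b * Complex.I)
      = Complex.exp ((-2 * b : ℝ) * Complex.I)
        * (Complex.exp (Complex.I * (-2 * (a - b) : ℝ)) - 1) := by
    rw [mul_sub, ← Complex.exp_add]
    congr 2 <;> push_cast <;> ring
  rw [e, norm_mul, Complex.norm_exp_ofReal_mul_I, one_mul]
  refine Real.norm_exp_I_mul_ofReal_sub_one_le.trans ?_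
  rw [Real.norm_eq_abs, abs_mul, abs_neg, abs_two]

/-- The difference `w` of two angles solves a linear equation `w' = (mu - lam) + k w` with `|k| ≤ 2
‖q‖`. Variation of constants gives `c = ∫ exp (K 1 - K x)`; its positivity yields monotonicity in
`lam`, its upper bound continuity. -/
theorem exists_angle_sub_eq (lam mu : ℝ) :
    ∃ c : ℝ, 0 < c ∧ c ≤ Real.exp (2 * ∫ t in (0 : ℝ)..1, ‖q t‖) ∧
      angle q Q mu 1 - angle q Q lam 1 = (mu - lam) * c := by
  set w : ℝ → ℝ := fun x ↦ angle q Q mu x - angle q Q lam x with hw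
  set d : ℝ → ℝ := fun x ↦ (q x * (Complex.exp (-2 * angle q Q mu x * Complex.I)
    - Complex.exp (-2 * angle q Q lam x * Complex.I))).im with hd
  have hwP : HasPrim w (fun x ↦ (mu - lam) + d x) := by
    refine ((hasPrim_angle hq hQ mu).add ((hasPrim_angle hq hQ lam).clm
      (-ContinuousLinearMap.id ℝ ℝ))).congr (fun x _ ↦ by simp [hw, sub_eq_add_neg])
      (ae_of_all _ fun x _ ↦ ?_)
    simp only [hd, mul_sub, Complex.sub_im]
    simp
    ring
  have hdint : IntervalIntegrable d volume 0 1 := by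
    have := hwP.1.sub (intervalIntegrable_const (c := mu - lam))
    simpa using this
  have hdle : ∀ x, |d x| ≤ 2 * ‖q x‖ * |w x| := by
    intro x
    refine (Complex.abs_im_le_norm _).trans ?_
    rw [norm_mul]
    calc _ ≤ ‖q x‖ * (2 * |angle q Q mu x - angle q Q lam x|) := by
          gcongr; exact norm_exp_sub_exp_le _ _
      _ = _ := by ring
  -- Where `w` vanishes so does `d`, by `hdle`, so the value `0` of the quotient there is harmless.
  set k : ℝ → ℝ := fun x ↦ d x / w x with hk
  have hkw : ∀ x, k x * w x = d x := by
    intro x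
    by_cases h : w x = 0
    · have := hdle x
      rw [h, abs_zero, mul_zero] at this
      rw [h, mul_zero, abs_nonpos_iff.1 this]
    · exact div_mul_cancel₀ _ h
  have hkle : ∀ x, ‖k x‖ ≤ 2 * ‖q x‖ := by
    intro x
    simp only [hk]
    rw [norm_div, Real.norm_eq_abs, Real.norm_eq_abs]
    by_cases h : w x = 0
    · simp [h]
    · rw [div_le_iff₀ (abs_pos.2 h)]
      exact hdle x
  have hkint : IntervalIntegrable k volume 0 1 := by
    refine (hq.norm.const_mul 2).mono_fun ?_ (ae_of_all _ fun x ↦ ?_)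
    · exact (hdint.aestronglyMeasurable_restrict_uIoc.aemeasurable.div
        hwP.intervalIntegrable.aestronglyMeasurable_restrict_uIoc.aemeasurable).aestronglyMeasurable
    · exact (hkle x).trans (le_abs_self _)
  set K : ℝ → ℝ := fun x ↦ ∫ t in (0 : ℝ)..x, k t with hK
  have hKP : HasPrim K k := ⟨hkint, fun x _ ↦ by simp [hK]⟩
  have hKn : HasPrim (fun x ↦ -K x) (fun x ↦ -k x) := by
    simpa using hKP.clm (-ContinuousLinearMap.id ℝ ℝ)
  have hmain := hwP.mul hKn.rexp
  have h1 := hmain.2 1 (by simp)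
  have e0 : w 0 = 0 := by simp [hw, angle_zero]
  have e1 : ∀ x, ((mu - lam) + d x) * Real.exp (-K x) + w x * (Real.exp (-K x) * -k x)
      = (mu - lam) * Real.exp (-K x) := fun x ↦ by rw [← hkw x]; ring
  simp only [e0, e1, zero_mul, zero_add, intervalIntegral.integral_const_mul] at h1
  have hKc : ContinuousOn (fun x ↦ Real.exp (K 1 - K x)) (Icc 0 1) :=
    Real.continuous_exp.comp_continuousOn (continuousOn_const.sub hKP.continuousOn)
  have hKi : IntervalIntegrable (fun x ↦ Real.exp (K 1 - K x)) volume 0 1 :=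
    ContinuousOn.intervalIntegrable (by rwa [uIcc_of_le zero_le_one])
  refine ⟨∫ x in (0 : ℝ)..1, Real.exp (K 1 - K x), ?_, ?_, ?_⟩
  · exact intervalIntegral.intervalIntegral_pos_of_pos hKi (fun x ↦ Real.exp_pos _) one_pos
  · have h2 : ∀ x ∈ Icc (0 : ℝ) 1,
        Real.exp (K 1 - K x) ≤ Real.exp (2 * ∫ t in (0 : ℝ)..1, ‖q t‖) := by
      intro x hx
      have h01 : (0 : ℝ) ∈ Icc (0 : ℝ) 1 := by simp
      have h11 : (1 : ℝ) ∈ Icc (0 : ℝ) 1 := by simp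
      rw [Real.exp_le_exp, hK]
      beta_reduce
      rw [intervalIntegral.integral_interval_sub_left
        (intervalIntegrable_sub_of_mem hkint h01 h11) (intervalIntegrable_sub_of_mem hkint h01 hx),
        ← intervalIntegral.integral_const_mul]
      refine (le_abs_self _).trans ((intervalIntegral.norm_integral_le_of_norm_le
        (g := fun t ↦ 2 * ‖q t‖) hx.2 (ae_of_all _ fun t _ ↦ hkle t)
        (intervalIntegrable_sub_of_mem (hq.norm.const_mul 2) hx h11)).trans ?_)
      exact intervalIntegral.integral_mono_interval hx.1 hx.2 le_rfl
        (ae_of_all _ fun t ↦ by positivity) (hq.norm.const_mul 2)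
    have h3 := intervalIntegral.integral_mono_on zero_le_one hKi intervalIntegrable_const h2
    simpa using h3
  · have e2 : ∀ x, Real.exp (K 1 - K x) = Real.exp (K 1) * Real.exp (-K x) := fun x ↦ by
      rw [← Real.exp_add, sub_eq_add_neg]
    simp only [e2, intervalIntegral.integral_const_mul]
    rw [mul_left_comm, ← h1, mul_left_comm, ← Real.exp_add]
    simp [hw]

theorem strictMono_angle : StrictMono fun lam ↦ angle q Q lam 1 := by
  intro lam mu h
  obtain ⟨c, hc, -, he⟩ := exists_angle_sub_eq hq hQ lam mu
  have : 0 < (mu - lam) * c := mul_pos (sub_pos.2 h) hc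
  beta_reduce
  linarith

theorem continuous_angle : Continuous fun lam ↦ angle q Q lam 1 := by
  refine (LipschitzWith.of_dist_le_mul
    (K := (Real.exp (2 * ∫ t in (0 : ℝ)..1, ‖q t‖)).toNNReal) fun mu lam ↦ ?_).continuous
  obtain ⟨c, hc, hc', he⟩ := exists_angle_sub_eq hq hQ lam mu
  rw [Real.dist_eq, he, abs_mul, abs_of_pos hc, Real.coe_toNNReal _ (Real.exp_pos _).le, mul_comm,
    Real.dist_eq]
  gcongr

theorem surjective_angle : Function.Surjective fun lam ↦ angle q Q lam 1 := by
  apply (continuous_angle hq hQ).surjective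
  · refine tendsto_atTop_mono (f := fun lam ↦ lam - ∫ t in (0 : ℝ)..1, ‖q t‖) (fun lam ↦ ?_)
      (tendsto_atTop_add_const_right _ _ tendsto_id)
    linarith [(abs_le.1 (abs_angle_sub_le hq hQ lam)).1]
  · refine tendsto_atBot_mono (f := fun lam ↦ lam + ∫ t in (0 : ℝ)..1, ‖q t‖) (fun lam ↦ ?_)
      (tendsto_atBot_add_const_right _ _ tendsto_id)
    linarith [(abs_le.1 (abs_angle_sub_le hq hQ lam)).2]

/-! ### Asymptotics for large spectral parameter -/

omit hQ hq [Fact (p ≠ ∞)] in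
theorem tendsto_pairing_expPos (f : CircLp p) :
    Tendsto (fun lam ↦ pairing _ (bddMeas_expPos lam) f) (cocompact ℝ) (𝓝 0) := by
  have h := Real.tendsto_integral_exp_smul_cocompact
    ((Ioc (0 : ℝ) 1).indicator fun x ↦ f (x : UnitAddCircle))
  -- The Fourier character carries `-2π`, so the Riemann–Lebesgue lemma is used at frequency `lam /
  -- π`.
  have hm : Tendsto (fun lam : ℝ ↦ lam * Real.pi⁻¹) (cocompact ℝ) (cocompact ℝ) :=
    (Homeomorph.mulRight₀ Real.pi⁻¹ (inv_ne_zero Real.pi_ne_zero)).isClosedEmbedding.tendsto_cocompact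
  refine (h.comp hm).congr fun lam ↦ ?_
  rw [Function.comp_apply, pairing_apply, integral_circMeas,
    intervalIntegral.integral_of_le zero_le_one, ← integral_indicator measurableSet_Ioc]
  refine integral_congr_ae (ae_of_all _ fun x ↦ ?_)
  by_cases hx : x ∈ Ioc (0 : ℝ) 1
  · simp only [indicator_of_mem hx, expPos, pos_coe hx, Circle.smul_def, Real.fourierChar_apply,
      smul_eq_mul]
    congr 2
    push_cast
    field_simp
  · simp [indicator_of_notMem hx]

omit hQ in
-- Riemann–Lebesgue holds uniformly in `x`: the kernels form a compact subset of `L_p`, covered by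
-- finitely many small balls, and the pairings have norm at most one.
theorem eventually_norm_amplitude_sub_one_lt {ε : ℝ} (hε : 0 < ε) :
    ∀ᶠ lam in cocompact ℝ, ∀ x ∈ Icc (0 : ℝ) 1, ‖amplitude q Q lam x - 1‖ < ε := by
  have hK := isCompact_Icc.image_of_continuousOn (continuousOn_kernel hq Q)
  obtain ⟨t, ht, htf, hcov⟩ := hK.finite_cover_balls (half_pos hε)
  have hev : ∀ᶠ lam in cocompact ℝ, ∀ f ∈ t, ‖pairing _ (bddMeas_expPos lam) f‖ < ε / 2 := by
    rw [eventually_all_finite htf]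
    intro f _
    have := (tendsto_pairing_expPos f).eventually (Metric.ball_mem_nhds 0 (half_pos hε))
    simpa using this
  filter_upwards [hev] with lam hlam x hx
  obtain ⟨f, hf, hxf⟩ := mem_iUnion₂.1 (hcov (mem_image_of_mem _ hx))
  rw [amplitude, add_sub_cancel_left]
  have h1 := norm_pairing_le (bddMeas_expPos lam) (C := 1) (fun s ↦ (norm_expPos lam s).le)
    (kernel q Q x - f)
  rw [map_sub, one_mul, ← dist_eq_norm (kernel q Q x)] at h1
  have h2 : dist (kernel q Q x) f < ε / 2 := hxf
  have h3 := norm_add_le (pairing _ (bddMeas_expPos lam) (kernel q Q x)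
    - pairing _ (bddMeas_expPos lam) f) (pairing _ (bddMeas_expPos lam) f)
  rw [sub_add_cancel] at h3
  linarith [hlam f hf]

theorem amplitude_eq_exp (lam : ℝ) {x : ℝ} (hx : x ∈ Icc (0 : ℝ) 1) :
    amplitude q Q lam x = Complex.exp (logAmp q Q lam x) := by
  have h := complexSol_eq_exp hq hQ lam hx
  rw [complexSol, Complex.exp_add] at h
  exact mul_left_cancel₀ (Complex.exp_ne_zero _) h

/-- For large `lam` the amplitude has positive real part on all of `[0,1]`. The imaginary part of
`logAmp` starts at `0` and so cannot reach `±π/2`; at `1` it is the principal argument of a number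
tending to `1`. -/
theorem tendsto_angle_sub : Tendsto (fun lam ↦ angle q Q lam 1 - lam) (cocompact ℝ) (𝓝 0) := by
  have hlim : Tendsto (fun lam ↦ amplitude q Q lam 1) (cocompact ℝ) (𝓝 1) := by
    rw [Metric.tendsto_nhds]
    intro ε hε
    filter_upwards [eventually_norm_amplitude_sub_one_lt hq (Q := Q) hε] with lam h
    rw [dist_eq_norm]
    exact h 1 (by simp)
  have harg : Tendsto (fun lam ↦ (amplitude q Q lam 1).arg) (cocompact ℝ) (𝓝 0) := by
    have := (Complex.continuousAt_arg (x := 1) (by simp)).tendsto.comp hlim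
    rwa [Complex.arg_one] at this
  refine harg.congr' ?_
  filter_upwards [eventually_norm_amplitude_sub_one_lt hq (Q := Q) one_pos] with lam h
  have hre : ∀ x ∈ Icc (0 : ℝ) 1, 0 < (amplitude q Q lam x).re := by
    intro x hx
    have h1 := (Complex.abs_re_le_norm _).trans_lt (h x hx)
    rw [Complex.sub_re, Complex.one_re, abs_lt] at h1
    linarith
  have hc : ContinuousOn (fun x ↦ |(logAmp q Q lam x).im|) (Icc 0 1) :=
    (Complex.continuous_im.comp_continuousOn (hasPrim_logAmp hq hQ lam).continuousOn).abs
  have hlt : |(logAmp q Q lam 1).im| < Real.pi / 2 := by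
    by_contra hge
    obtain ⟨x, hx, hx'⟩ := intermediate_value_Icc zero_le_one hc
      (show Real.pi / 2 ∈ Icc |(logAmp q Q lam 0).im| |(logAmp q Q lam 1).im| from
        ⟨by rw [logAmp_zero, Complex.zero_im, abs_zero]; exact (half_pos Real.pi_pos).le, not_lt.1 hge⟩)
    have h1 := hre x hx
    rw [amplitude_eq_exp hq hQ lam hx, Complex.exp_re, ← Real.cos_abs] at h1
    beta_reduce at hx'
    rw [hx', Real.cos_pi_div_two, mul_zero] at h1
    exact lt_irrefl _ h1
  rw [abs_lt] at hlt
  have hpi := Real.pi_pos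
  rw [amplitude_eq_exp hq hQ lam (by simp), ← Complex.log_im,
    Complex.log_exp (by linarith) (by linarith)]
  simp [angle]

end Solution

/-! ### Eigenvalues -/

section Eigenvalues

variable {p : ℝ≥0∞} [Fact (1 ≤ p)] [Fact (p ≠ ∞)] {q₁ q₂ : ℝ → ℝ}
  (hq : IntervalIntegrable (complexPot q₁ q₂) volume 0 1) {Q : CircLp p}
  (hQ : Q =ᵐ[circMeas] fun s ↦ complexPot q₁ q₂ (pos s))

include hq hQ

theorem isCSolution_complexSol (lam : ℝ) :
    IsCSolution q₁ q₂ lam (reImVec (complexSol (complexPot q₁ q₂) Q lam)) := by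
  refine ⟨isDiracSolution_iff.2 (isComplexSolution_complexSol hq hQ lam).isIntSolution, ?_, ?_⟩
  · simp [reImVec, complexSol_zero hq hQ]
  · simp [reImVec, complexSol_zero hq hQ]

theorem eq_smul_complexSol {lam : ℝ} {u : ℝ → Fin 2 → ℂ} (hu : IsDiracSolution q₁ q₂ lam u)
    (hu1 : u 0 1 = 0) {x : ℝ} (hx : x ∈ Icc (0 : ℝ) 1) :
    u x = u 0 0 • reImVec (complexSol (complexPot q₁ q₂) Q lam) x := by
  obtain ⟨hc, hc0, hc1⟩ := isCSolution_complexSol hq hQ lam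
  obtain ⟨w, hw, hw0⟩ := exists_second_solution hq hQ lam
  have h := (isDiracSolution_iff.1 hc).eq_smul hw.isIntSolution (isDiracSolution_iff.1 hu) hc0 hc1
    (by simp [reImVec, hw0]) (by simp [reImVec, hw0]) hu1 hx
  funext i
  fin_cases i
  · exact h.1
  · exact h.2

theorem re_complexSol_one_eq_zero_iff (lam : ℝ) :
    (complexSol (complexPot q₁ q₂) Q lam 1).re = 0
      ↔ Real.cos (angle (complexPot q₁ q₂) Q lam 1) = 0 := by
  rw [complexSol_polar hq hQ lam (by simp), Complex.re_ofReal_mul, Complex.exp_ofReal_mul_I_re,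
    mul_eq_zero, or_iff_right (Real.exp_ne_zero _)]

theorem mem_eigenvaluesA₁_iff (lam : ℂ) : lam ∈ eigenvaluesA₁ q₁ q₂ ↔
    ∃ mu : ℝ, (mu : ℂ) = lam ∧ Real.cos (angle (complexPot q₁ q₂) Q mu 1) = 0 := by
  simp only [← re_complexSol_one_eq_zero_iff hq hQ]
  constructor
  · rintro ⟨u, ⟨hac, -, hu0, hu1⟩, hne, hsol⟩
    have hD : IsDiracSolution q₁ q₂ lam u := ⟨hac, hsol⟩
    rw [ae_volUnit_iff] at hne
    have him := (isDiracSolution_iff.1 hD).im_eq_zero hu0 hu1 hne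
    have hlam : ((lam.re : ℝ) : ℂ) = lam := Complex.ext (by simp) (by simp [him])
    refine ⟨lam.re, hlam, ?_⟩
    rw [← hlam] at hD
    have h1 := congrFun (eq_smul_complexSol hq hQ hD hu0 (x := 1) (by simp)) 0
    rw [hu1, Pi.smul_apply, smul_eq_mul, eq_comm, mul_eq_zero] at h1
    rcases h1 with h1 | h1
    · refine absurd (ae_of_all _ fun x hx ↦ ?_) hne
      rw [eq_smul_complexSol hq hQ hD hu0 hx, h1, zero_smul]
    · simpa [reImVec] using h1
  · rintro ⟨mu, rfl, hmu⟩
    obtain ⟨hc, hc0, hc1⟩ := isCSolution_complexSol hq hQ mu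
    refine ⟨_, ⟨hc.1, fun i ↦ ?_, hc1, by simp [reImVec, hmu]⟩, fun h ↦ ?_, hc.2⟩
    -- The expression `ℓ_Q u` agrees almost everywhere with `mu u`, which is bounded, hence square
    -- integrable.
    · have hcont : ContinuousOn
          (fun x ↦ ((mu : ℂ) • reImVec (complexSol (complexPot q₁ q₂) Q mu) x) i) (Icc 0 1) := by
        have := (hc.1 i).continuousOn
        rw [uIcc_of_le zero_le_one] at this
        exact continuousOn_const.mul this
      obtain ⟨C, hC⟩ := isCompact_Icc.exists_bound_of_continuousOn hcont
      have hm : MemLp (fun x ↦ ((mu : ℂ) • reImVec (complexSol (complexPot q₁ q₂) Q mu) x) i) 2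
          volUnit := by
        have : IsFiniteMeasure volUnit := by unfold volUnit; infer_instance
        refine MemLp.of_bound ((hcont.mono Ioo_subset_Icc_self).aestronglyMeasurable
          measurableSet_Ioo) C ?_
        exact ae_volUnit_iff.2 (ae_of_all _ hC)
      refine hm.ae_eq ?_
      filter_upwards [hc.2] with x hx
      rw [hx]
    · rw [ae_volUnit_iff] at h
      have hz : ∀ x ∈ Icc (0 : ℝ) 1, reImVec (complexSol (complexPot q₁ q₂) Q mu) x ≠ 0 := by
        intro x hx h0
        refine complexSol_ne_zero hq hQ mu hx (Complex.ext ?_ ?_)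
        · simpa [reImVec] using congrFun h0 0
        · simpa [reImVec] using congrFun h0 1
      have h0 : volume (Icc (0 : ℝ) 1) = 0 := by
        refine measure_eq_zero_iff_ae_notMem.2 ?_
        filter_upwards [h] with x hx hx' using hz x hx' (hx hx')
      simp at h0

/-- The eigenvalue numbered by its Prüfer angle `π (n + 1/2)`. -/
theorem exists_eigenvalue (n : ℤ) :
    ∃ lam : ℝ, angle (complexPot q₁ q₂) Q lam 1 = Real.pi * (n + 1 / 2) :=
  surjective_angle hq hQ _

theorem exists_enumeratesA₁ : ∃ lam : ℤ → ℝ, EnumeratesA₁ q₁ q₂ lam := by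
  choose lam hlam using exists_eigenvalue hq hQ
  refine ⟨lam, ?_, ?_⟩
  · intro m n hmn
    rw [← (strictMono_angle hq hQ).lt_iff_lt]
    rw [hlam, hlam]
    have : (m : ℝ) < n := by exact_mod_cast hmn
    nlinarith [Real.pi_pos]
  · ext z
    rw [mem_eigenvaluesA₁_iff hq hQ]
    constructor
    · rintro ⟨n, rfl⟩
      refine ⟨lam n, rfl, Real.cos_eq_zero_iff.2 ⟨n, ?_⟩⟩
      rw [hlam]; ring
    · rintro ⟨mu, rfl, hmu⟩
      obtain ⟨k, hk⟩ := Real.cos_eq_zero_iff.1 hmu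
      refine ⟨k, ?_⟩
      beta_reduce
      congr 1
      refine (strictMono_angle hq hQ).injective ?_
      rw [hlam, hk]; ring

omit hq hQ [Fact (1 ≤ p)] [Fact (p ≠ ∞)] in
-- Surjectivity leaves no gaps, so every step is exactly `1`.
theorem StrictMono.eq_add_of_surjective {m : ℤ → ℤ} (hm : StrictMono m)
    (hs : Function.Surjective m) (n : ℤ) : m n = n + m 0 := by
  have hstep : ∀ n, m (n + 1) = m n + 1 := by
    intro n
    obtain ⟨j, hj⟩ := hs (m n + 1)
    have h1 : n < j := hm.lt_iff_lt.1 (by omega)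
    have h2 : m (n + 1) ≤ m j := hm.monotone h1
    have h3 : m n < m (n + 1) := hm (by omega)
    omega
  induction n using Int.induction_on with
  | zero => simp
  | succ i ih => rw [hstep, ih]; ring
  | pred i ih =>
    have := hstep (-(i : ℤ) - 1)
    rw [sub_add_cancel] at this
    omega

theorem EnumeratesA₁.exists_shift {lam : ℤ → ℝ} (h : EnumeratesA₁ q₁ q₂ lam) :
    ∃ k : ℤ, ∀ n, angle (complexPot q₁ q₂) Q (lam n) 1 = Real.pi * ((n + k : ℤ) + 1 / 2) := by
  have hmem : ∀ n, ∃ m : ℤ, angle (complexPot q₁ q₂) Q (lam n) 1 = Real.pi * (m + 1 / 2) := by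
    intro n
    have : (lam n : ℂ) ∈ eigenvaluesA₁ q₁ q₂ := h.2 ▸ mem_range_self n
    obtain ⟨mu, hmu, hc⟩ := (mem_eigenvaluesA₁_iff hq hQ _).1 this
    rw [Complex.ofReal_inj.1 hmu] at hc
    obtain ⟨k, hk⟩ := Real.cos_eq_zero_iff.1 hc
    exact ⟨k, by rw [hk]; ring⟩
  choose m hm using hmem
  have hpi := Real.pi_pos
  have hmono : StrictMono m := by
    intro i j hij
    have := strictMono_angle hq hQ (h.1 hij)
    beta_reduce at this
    rw [hm, hm, mul_lt_mul_iff_right₀ hpi] at this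
    have : (m i : ℝ) < m j := by linarith
    exact_mod_cast this
  have hsurj : Function.Surjective m := by
    intro k
    obtain ⟨mu, hmu⟩ := exists_eigenvalue hq hQ k
    have : (mu : ℂ) ∈ eigenvaluesA₁ q₁ q₂ := by
      refine (mem_eigenvaluesA₁_iff hq hQ _).2 ⟨mu, rfl, Real.cos_eq_zero_iff.2 ⟨k, ?_⟩⟩
      rw [hmu]; ring
    rw [← h.2] at this
    obtain ⟨n, hn⟩ := this
    have hn' : lam n = mu := Complex.ofReal_inj.1 hn
    refine ⟨n, ?_⟩
    have h1 := hm n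
    rw [hn', hmu] at h1
    have h2 := mul_left_cancel₀ hpi.ne' h1
    have h3 : (m n : ℝ) = k := by linarith
    exact_mod_cast h3
  exact ⟨m 0, fun n ↦ by rw [hm n, hmono.eq_add_of_surjective hsurj n]⟩

theorem normH_zpow {lam : ℝ} {c : ℝ → Fin 2 → ℂ} (hc : IsCSolution q₁ q₂ lam c) :
    normH c ^ (-2 : ℤ)
      = (∫ x in (0 : ℝ)..1, ‖amplitude (complexPot q₁ q₂) Q lam x‖ ^ 2)⁻¹ := by
  have h : ∫ x, (‖c x 0‖ ^ 2 + ‖c x 1‖ ^ 2) ∂volUnit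
      = ∫ x in (0 : ℝ)..1, ‖amplitude (complexPot q₁ q₂) Q lam x‖ ^ 2 := by
    rw [intervalIntegral.integral_of_le zero_le_one, ← volUnit_eq]
    refine integral_congr_ae (ae_volUnit_iff.2 (ae_of_all _ fun x hx ↦ ?_))
    beta_reduce
    rw [eq_smul_complexSol hq hQ hc.1 hc.2.2 hx, hc.2.1, one_smul]
    have hn : ‖amplitude (complexPot q₁ q₂) Q lam x‖
        = ‖complexSol (complexPot q₁ q₂) Q lam x‖ := by
      rw [complexSol, norm_mul, show Complex.I * lam * x = ((lam * x : ℝ) : ℂ) * Complex.I by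
        push_cast; ring, Complex.norm_exp_ofReal_mul_I, one_mul]
    have hr : ∀ z : ℂ, ‖z‖ ^ 2 = z.re ^ 2 + z.im ^ 2 := fun z ↦ by
      rw [← Complex.normSq_eq_norm_sq, Complex.normSq_apply, sq, sq]
    rw [hn, hr (complexSol _ _ _ _)]
    simp [reImVec]
  rw [normH, h, zpow_neg, zpow_ofNat, Real.sq_sqrt]
  exact intervalIntegral.integral_nonneg zero_le_one fun _ _ ↦ by positivity

end Eigenvalues

/-! ### The sequence of norming constants -/

section Norming

/-- The function `exp (-π i s)` on the circle, read on `(0,1]`. -/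
def halfTwist (s : UnitAddCircle) : ℂ := expPos (Real.pi / 2) s

theorem measurable_halfTwist : Measurable halfTwist := (bddMeas_expPos _).1

theorem norm_halfTwist_le (s : UnitAddCircle) : ‖halfTwist s‖ ≤ 1 := (norm_expPos _ s).le

theorem measurable_ofReal_pos : Measurable fun s ↦ (pos s : ℂ) :=
  Complex.measurable_ofReal.comp measurable_pos

theorem measurable_neg_pos : Measurable fun s ↦ -(pos s : ℂ) := measurable_ofReal_pos.neg

theorem measurable_one_sub_pos : Measurable fun s ↦ 1 - (pos s : ℂ) :=
  measurable_const.sub measurable_ofReal_pos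

theorem norm_pos_le (s : UnitAddCircle) : ‖(pos s : ℂ)‖ ≤ 1 := by
  rw [Complex.norm_real, Real.norm_of_nonneg (pos_mem s).1.le]
  exact (pos_mem s).2

theorem norm_neg_pos_le (s : UnitAddCircle) : ‖-(pos s : ℂ)‖ ≤ 1 := by
  rw [norm_neg]; exact norm_pos_le s

theorem norm_one_sub_pos_le (s : UnitAddCircle) : ‖1 - (pos s : ℂ)‖ ≤ 1 := by
  rw [← Complex.ofReal_one, ← Complex.ofReal_sub, Complex.norm_real,
    Real.norm_of_nonneg (by linarith [(pos_mem s).2])]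
  linarith [(pos_mem s).1]

theorem fourier_eq_exp (n : ℤ) (s : UnitAddCircle) :
    fourier n s = Complex.exp (2 * Real.pi * Complex.I * n * pos s) := by
  conv_lhs => rw [← coe_pos s]
  rw [fourier_coe_apply]
  simp

theorem expPos_eq {n : ℤ} {lam : ℝ} {X : ℂ}
    (hX : X = 2 * Complex.I * (lam - Real.pi * (n + 1 / 2))) (s : UnitAddCircle) :
    expPos lam s = fourier (-n) s * (Complex.exp (X * -pos s) * halfTwist s) := by
  rw [fourier_eq_exp, halfTwist, expPos, expPos, ← Complex.exp_add, ← Complex.exp_add, hX]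
  congr 1
  push_cast
  ring

variable {p : ℝ≥0∞} [Fact (1 ≤ p)] [Fact (p ≠ ∞)] {q : ℝ → ℂ}
  (hq : IntervalIntegrable q volume 0 1) {Q : CircLp p}
  (hQ : Q =ᵐ[circMeas] fun s ↦ q (pos s))

omit [Fact (p ≠ ∞)] in
theorem pairing_expPos_eq {n : ℤ} {lam : ℝ} {X : ℂ}
    (hX : X = 2 * Complex.I * (lam - Real.pi * (n + 1 / 2))) (F : CircLp p) :
    pairing _ (bddMeas_expPos lam) F
      = ∫ s, fourier (-n) s * (Complex.exp (X * -pos s) * halfTwist s * F s) ∂circMeas := by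
  rw [pairing_apply]
  refine integral_congr_ae (ae_of_all _ fun s ↦ ?_)
  beta_reduce
  rw [expPos_eq hX]
  ring

include hq hQ

/-- At angle `π (n + 1/2)` the quotient `conj a / a` at `1` is `exp (2i (lam - angle))`. -/
theorem exp_mul_amplitude_one {n : ℤ} {lam : ℝ}
    (h : angle q Q lam 1 = Real.pi * (n + 1 / 2)) :
    Complex.exp (2 * Complex.I * (lam - Real.pi * (n + 1 / 2))) * amplitude q Q lam 1
      = starRingEnd ℂ (amplitude q Q lam 1) := by
  have e1 : amplitude q Q lam 1
      = Complex.exp (-(Complex.I * lam)) * complexSol q Q lam 1 := by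
    rw [complexSol, ← mul_assoc, ← Complex.exp_add]
    simp
  rw [e1, complexSol_polar hq hQ lam (by simp), h]
  simp only [map_mul, ← Complex.exp_conj, Complex.conj_ofReal, map_neg, Complex.conj_I]
  rw [mul_left_comm _ (Real.exp _ : ℂ), mul_left_comm _ (Real.exp _ : ℂ),
    mul_left_comm _ (Real.exp _ : ℂ), ← Complex.exp_add, ← Complex.exp_add, ← Complex.exp_add]
  congr 2
  push_cast
  ring

/-- With `u = a(1) - 1` the boundary condition becomes `exp X - 1 = conj u - exp X * u`. The
integrand of `u` contains `exp (-X s)`. As `X` is imaginary, conjugation turns this into powers of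
`X` with weight `s` (the `Y k`), while the factor `exp X` changes `-s` to `1 - s` (the `Z k`). -/
theorem exists_fc_eq_eigenvalue_shift {lam : ℤ → ℝ}
    (h : ∀ n : ℤ, angle q Q (lam n) 1 = Real.pi * (n + 1 / 2)) :
    ∃ f : CircLp p, ∀ n : ℤ, fc n f = 2 * Complex.I * (lam n - Real.pi * (n + 1 / 2)) := by
  set X : ℤ → ℂ := fun n ↦ 2 * Complex.I * (lam n - Real.pi * (n + 1 / 2)) with hXdef
  set F := kernel q Q 1
  set Y : ℕ → CircLp p := fun k ↦ mulOp _ (bddMeas_expCoef measurable_ofReal_pos norm_pos_le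
    measurable_halfTwist norm_halfTwist_le k) F with hY
  set Z : ℕ → CircLp p := fun k ↦ mulOp _ (bddMeas_expCoef
    measurable_one_sub_pos norm_one_sub_pos_le
    measurable_halfTwist norm_halfTwist_le k) F with hZ
  refine exists_fc_eq_of_exp_eq (C := fun k ↦ reflConj (Y k) - Z k) ?_ ?_ fun n ↦ ?_
  · refine Summable.of_nonneg_of_le (fun _ ↦ norm_nonneg _) (fun k ↦ ?_)
      ((Real.summable_pow_div_factorial 1).mul_right (2 * ‖F‖))
    have h1 : ‖Y k‖ ≤ ((k.factorial : ℝ))⁻¹ * ‖F‖ := norm_mulOp_expCoef_le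
      measurable_ofReal_pos norm_pos_le measurable_halfTwist norm_halfTwist_le k F
    have h2 : ‖Z k‖ ≤ ((k.factorial : ℝ))⁻¹ * ‖F‖ := norm_mulOp_expCoef_le
      measurable_one_sub_pos norm_one_sub_pos_le measurable_halfTwist norm_halfTwist_le k F
    rw [one_pow, one_div]
    linarith [norm_sub_le (reflConj (Y k)) (Z k), norm_reflConj_le (Y k)]
  · have hpi := Real.pi_pos
    have hM := fun n ↦ abs_le.1 (abs_angle_sub_le hq hQ (lam n))
    set M := ∫ t in (0 : ℝ)..1, ‖q t‖
    -- The angle at `lam n` is `π (n + 1/2)` and lies within `M` of `lam n`.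
    have hlam : Tendsto lam cofinite (cocompact ℝ) := by
      rw [Int.cofinite_eq, cocompact_eq_atBot_atTop]
      refine Tendsto.sup_sup ?_ ?_
      · refine tendsto_atBot_mono (fun n ↦ ?_) ((tendsto_atBot_add_const_right _ (1 / 2 + M / Real.pi)
          (tendsto_intCast_atBot_iff.2 tendsto_id)).const_mul_atBot hpi)
        have e : Real.pi * ((n : ℝ) + (1 / 2 + M / Real.pi)) = Real.pi * (n + 1 / 2) + M := by
          field_simp
          ring
        rw [id, e, ← h n]
        linarith [(hM n).1]
      · refine tendsto_atTop_mono (fun n ↦ ?_) ((tendsto_atTop_add_const_right _ (1 / 2 - M / Real.pi)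
          (tendsto_intCast_atTop_iff.2 tendsto_id)).const_mul_atTop hpi)
        have e : Real.pi * ((n : ℝ) + (1 / 2 - M / Real.pi)) = Real.pi * (n + 1 / 2) - M := by
          field_simp
          ring
        rw [id, e, ← h n]
        linarith [(hM n).2]
    have h1 := ((tendsto_angle_sub hq hQ).comp hlam)
    have h2 : Tendsto (fun n ↦ (-2 * Complex.I) * ((angle q Q (lam n) 1 - lam n : ℝ) : ℂ)) cofinite
        (𝓝 ((-2 * Complex.I) * ((0 : ℝ) : ℂ))) :=
      ((Complex.continuous_ofReal.tendsto 0).comp h1).const_mul _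
    rw [Complex.ofReal_zero, mul_zero] at h2
    refine h2.congr fun n ↦ ?_
    rw [h n]
    push_cast
    ring
  · have hX : X n = 2 * Complex.I * (lam n - Real.pi * (n + 1 / 2)) := rfl
    have hXc : starRingEnd ℂ (-X n) = X n := by
      have h2 : starRingEnd ℂ 2 = 2 := map_ofNat _ 2
      rw [hX]
      simp [h2]
    set u := pairing _ (bddMeas_expPos (lam n)) F with hu
    have hY1 : HasSum (fun k ↦ X n ^ k * fc n (reflConj (Y k))) (starRingEnd ℂ u) := by
      have := hasSum_fc_mulOp_expCoef measurable_ofReal_pos norm_pos_le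
        measurable_halfTwist norm_halfTwist_le F n (-X n)
      simp only [neg_mul_comm (X n)] at this
      rw [← pairing_expPos_eq hX F, ← hu, ← Complex.hasSum_conj'] at this
      simpa only [map_mul, map_pow, hXc, ← fc_reflConj] using this
    have hZ1 : HasSum (fun k ↦ X n ^ k * fc n (Z k)) (Complex.exp (X n) * u) := by
      have := hasSum_fc_mulOp_expCoef measurable_one_sub_pos
        norm_one_sub_pos_le measurable_halfTwist norm_halfTwist_le F n (X n)
      convert! this using 1
      rw [hu, pairing_expPos_eq hX F, ← integral_const_mul]
      refine integral_congr_ae (ae_of_all _ fun s ↦ ?_)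
      beta_reduce
      rw [mul_sub, sub_eq_add_neg, Complex.exp_add, mul_one, mul_neg]
      ring
    have hA := exp_mul_amplitude_one hq hQ (h n)
    rw [amplitude, ← hu, ← hX, map_add, map_one] at hA
    have hT := hY1.sub hZ1
    have e : ∀ k, X n ^ k * fc n (reflConj (Y k) - Z k)
        = X n ^ k * fc n (reflConj (Y k)) - X n ^ k * fc n (Z k) := fun k ↦ by
      rw [map_sub, mul_sub]
    rw [tsum_congr e, hT.tsum_eq]
    linear_combination hA

theorem exists_fc_eq_norming {lam : ℤ → ℝ}
    (h : ∀ n : ℤ, angle q Q (lam n) 1 = Real.pi * (n + 1 / 2)) :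
    ∃ g : CircLp p, ∀ n : ℤ,
      1 + fc n g = (((∫ x in (0 : ℝ)..1, ‖amplitude q Q (lam n) x‖ ^ 2)⁻¹ : ℝ) : ℂ) := by
  obtain ⟨f, hf⟩ := exists_fc_eq_eigenvalue_shift hq hQ h
  set S : CircLp p →L[ℂ] CircLp p := substOp measurable_neg_pos norm_neg_pos_le
    measurable_halfTwist norm_halfTwist_le f with hS
  set U : ℝ → CircLp p := fun x ↦ S (kernel q Q x) with hU
  have hUc : ContinuousOn U (Icc 0 1) := S.continuous.comp_continuousOn (continuousOn_kernel hq Q)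
  have hJc : ContinuousOn (fun x ↦ reflConj (U x)) (Icc 0 1) :=
    reflConj.continuous.comp_continuousOn hUc
  -- This is `(1 + U)(1 + U*) - 1` in the convolution algebra, where `U*` is `reflConj U`; its
  -- coefficients are `|a|² - 1`.
  set V : ℝ → CircLp p := fun x ↦ U x + reflConj (U x) + conv (U x) (reflConj (U x)) with hV
  have hVc : ContinuousOn V (Icc 0 1) :=
    (hUc.add hJc).add ((conv.continuous.comp_continuousOn hUc).clm_apply hJc)
  have hVi : IntervalIntegrable V volume 0 1 :=
    ContinuousOn.intervalIntegrable (by rwa [uIcc_of_le zero_le_one])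
  have hfcU : ∀ (n : ℤ) (x : ℝ), 1 + fc n (U x) = amplitude q Q (lam n) x := by
    intro n x
    simp only [hU, hS]
    rw [fc_substOp, amplitude, pairing_expPos_eq rfl, hf n]
  have hfcV : ∀ (n : ℤ) (x : ℝ), fc n (V x)
      = ((‖amplitude q Q (lam n) x‖ ^ 2 : ℝ) : ℂ) - 1 := by
    intro n x
    simp only [hV]
    rw [map_add, map_add, fc_conv, fc_reflConj, ← Complex.normSq_eq_norm_sq,
      Complex.normSq_eq_conj_mul_self, ← hfcU, map_add, map_one]
    ring
  set y : CircLp p := ∫ x in (0 : ℝ)..1, V x with hy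
  have hi : ∀ n : ℤ, ContinuousOn (fun x ↦ ‖amplitude q Q (lam n) x‖ ^ 2) (Icc 0 1) := fun n ↦
    (continuousOn_amplitude hq Q (lam n)).norm.pow 2
  have hfcy : ∀ n : ℤ,
      1 + fc n y = ((∫ x in (0 : ℝ)..1, ‖amplitude q Q (lam n) x‖ ^ 2 : ℝ) : ℂ) := by
    intro n
    rw [hy, ← (fc n).intervalIntegral_comp_comm hVi]
    simp only [hfcV]
    rw [intervalIntegral.integral_sub, intervalIntegral.integral_ofReal]
    · simp
    · refine ContinuousOn.intervalIntegrable ?_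
      rw [uIcc_of_le zero_le_one]
      exact Complex.continuous_ofReal.comp_continuousOn (hi n)
    · exact intervalIntegrable_const
  have hpos : ∀ n : ℤ, 0 < ∫ x in (0 : ℝ)..1, ‖amplitude q Q (lam n) x‖ ^ 2 := by
    intro n
    refine intervalIntegral.intervalIntegral_pos_of_pos_on
      (ContinuousOn.intervalIntegrable (by rw [uIcc_of_le zero_le_one]; exact hi n))
      (fun x hx ↦ ?_) one_pos
    have : amplitude q Q (lam n) x ≠ 0 := by
      rw [amplitude_eq_exp hq hQ _ (Ioo_subset_Icc_self hx)]
      exact Complex.exp_ne_zero _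
    positivity
  obtain ⟨g, hg⟩ := exists_fc_eq_inv y fun n ↦ by
    rw [hfcy, Complex.ofReal_ne_zero]
    exact (hpos n).ne'
  refine ⟨g, fun n ↦ ?_⟩
  rw [hg, hfcy, Complex.ofReal_inv]
  ring

end Norming

/-! ### Return to the interval and to an arbitrary listing -/

theorem fourierE_eq_fc {p : ℝ≥0∞} [Fact (1 ≤ p)] (g : CircLp p) (k n : ℤ) :
    fourierE (fun x ↦ fourier (-k) (x : UnitAddCircle) * g (x : UnitAddCircle)) n
      = fc (n + k) g := by
  rw [fc_apply, integral_circMeas, intervalIntegral.integral_of_le zero_le_one, fourierE,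
    volUnit_eq]
  refine setIntegral_congr_fun measurableSet_Ioc fun x hx ↦ ?_
  rw [neg_add, fourier_add, ← mul_assoc]
  congr 2
  rw [fourier_eq_exp, pos_coe hx]
  congr 1
  push_cast
  ring

end

theorem theorem3p2 (p : ENNReal) (hp1 : 1 ≤ p) (hp : p ≠ ⊤) (q₁ q₂ : ℝ → ℝ)
    (hq₁ : MemLp q₁ p volUnit) (hq₂ : MemLp q₂ p volUnit) :
    (∃ lam : ℤ → ℝ, EnumeratesA₁ q₁ q₂ lam) ∧
    ∀ lam : ℤ → ℝ, EnumeratesA₁ q₁ q₂ lam →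
      (∀ n : ℤ, ∃ c : ℝ → Fin 2 → ℂ, IsCSolution q₁ q₂ (lam n : ℂ) c) ∧
      ∃ g : ℝ → ℂ, MemLp g p volUnit ∧
        ∀ (n : ℤ) (c : ℝ → Fin 2 → ℂ), IsCSolution q₁ q₂ (lam n : ℂ) c →
          ((normH c ^ (-2 : ℤ) : ℝ) : ℂ) = 1 + fourierE g n := by
  have : Fact (1 ≤ p) := ⟨hp1⟩
  have : Fact (p ≠ ⊤) := ⟨hp⟩
  have hmem : MemLp (complexPot q₁ q₂) p (volume.restrict (Set.Ioc 0 1)) := by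
    rw [← volUnit_eq]
    exact hq₂.ofReal.sub (hq₁.ofReal.const_mul Complex.I)
  have hq : IntervalIntegrable (complexPot q₁ q₂) volume 0 1 := by
    rw [intervalIntegrable_iff, Set.uIoc_of_le zero_le_one]
    exact hmem.integrable hp1
  have hmQ := hmem.comp_measurePreserving measurePreserving_pos
  have hQ := hmQ.coeFn_toLp
  refine ⟨exists_enumeratesA₁ hq hQ, fun lam hlam ↦
    ⟨fun n ↦ ⟨_, isCSolution_complexSol hq hQ (lam n)⟩, ?_⟩⟩
  obtain ⟨k, hk⟩ := hlam.exists_shift hq hQ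
  -- Shifting the listing by `k` restores the Prüfer numbering; the character in the final function
  -- undoes the shift.
  obtain ⟨g, hg⟩ := exists_fc_eq_norming hq hQ (lam := fun n ↦ lam (n - k)) fun n ↦ by
    rw [hk, sub_add_cancel]
  refine ⟨fun x ↦ fourier (-k) (x : UnitAddCircle) * g (x : UnitAddCircle), ?_,
    fun n c hc ↦ ?_⟩
  · have h1 : MemLp (fun s ↦ fourier (-k) s * g s) p circMeas := (bddMeas_fourier (-k)).memLp_mul g
    rw [volUnit_eq]
    exact h1.comp_measurePreserving measurePreserving_coe
  · rw [normH_zpow hq hQ hc, fourierE_eq_fc, hg, add_sub_cancel_right]
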